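/- Let $N$ be an odd squarefree positive integer, let $p$ be a prime dividing $N$, and let $T\in \mathrm{Sym}_2(\mathbb Z_p)$. Consider the $\mathbb Z_p$-lattices $$\mathcal L=\left\{\begin{pmatrix} a& b/N\\ c&-a\end{pmatrix}: a,b,c\in\mathbb Z_p\right\}\ \text{ with } Q(x)=N\det x,\qquad L_0=M_2(\mathbb Z_p)^{\mathrm{tr}=0}\ \text{ with } Q(x)=\det x,$$ each given by its Gram matrix $S$ in a $\mathbb Z_p$-basis $(e_i)$, with entries $\tfrac12\left(Q(e_i+e_j)-Q(e_i)-Q(e_j)\right)$ (any basis may be used). For a symmetric $m\times m$ matrix $S$ over $\mathbb Z_p$ the local density is $$\alpha_p(T,S)=\lim_{t\to\infty}p^{-t(2m-3)}\,\#\{x\in M_{m,2}(\mathbb Z/p^t):\ {}^txSx\equiv T \bmod p^t\}.$$ The representation density $\alpha_p(X,T,S)$ is the power series in $X$ that, for all sufficiently large $r$, converges at $X=p^{-r}$ to $\alpha_p(T,S\perp H^r)$, where $H=\begin{pmatrix}0&1/2\\1/2&0\end{pmatrix}$. Let $R_1(X,T,S)=\sum_{k\ge1}c_kX^k$ denote the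 part of Yang's decomposition $\alpha_p(X,T,S)=1+R_1(X,T,S)+R_2(X,T,S)$ that comes from the $b\in\mathrm{Sym}_2(\mathbb Q_p)/\mathrm{Sym}_2(\mathbb Z_p)$ with exactly one non-integral elementary divisor, that is $$c_k=\sum_{B} p^{-2mk}\sum_{x\in M_{m,2}(\mathbb Z/p^k)} e^{2\pi i\,\mathrm{tr}(B({}^txSx-T))/p^k},$$ where $B$ runs over the symmetric $2\times2$ matrices over $\mathbb Z/p^k$ with $\det B=0$ and at least one unit entry. Then the representation densities $\alpha_p(X,T,\mathcal L)$ and $\alpha_p(X,NT,L_0)$ exist and are unique, and $$\alpha_p(X,T,\mathcal L)=X^{-2}\left(p\,\alpha_p(X,NT,L_0)+(X-p)\left(R_1(X,NT,L_0)+\frac{X+p}{p}\right)\right).$$ If moreover $\det T\ne0$, then $\alpha_p(X,T,\mathcal L)$, $\alpha_p(X,NT,L_0)$ and $R_1(X,NT,L_0)$ are polynomials in $X$, and the values of the first two at $X=p^{-r}$ are the local densities $\alpha_p(T,\mathcal L\perp H^r)$ and $\alpha_p(NT,L_0\perp H^r)$ for every $r\ge0$. -/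

import Mathlib

open scoped PowerSeries

/-- The Gram matrix of `S ⊥ H ⊥ ⋯ ⊥ H` (`r` copies), where `H` is the hyperbolic plane with
Gram matrix `(0, 1/2; 1/2, 0)`, i.e. with quadratic form `(x, y) ↦ x y`.
(For odd `p`, `2` is a unit of `ℤ_p`, so `Ring.inverse 2` is its inverse.) -/
noncomputable def addHyperbolic {p : ℕ} [Fact p.Prime] {ι : Type} (S : Matrix ι ι ℤ_[p]) (r : ℕ) :
    Matrix (ι ⊕ (Fin 2 × Fin r)) (ι ⊕ (Fin 2 × Fin r)) ℤ_[p] :=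
  Matrix.fromBlocks S 0 0
    (Matrix.blockDiagonal fun _ : Fin r => !![0, Ring.inverse 2; Ring.inverse 2, 0])

/-- The number of solutions `x ∈ M_{m,2}(ℤ/p^t)` of `ᵗx S x ≡ T mod p^t`. -/
noncomputable def repCount {p : ℕ} [Fact p.Prime] {ι : Type} [Fintype ι]
    (S : Matrix ι ι ℤ_[p]) (T : Matrix (Fin 2) (Fin 2) ℤ_[p]) (t : ℕ) : ℕ :=
  Nat.card {x : Matrix ι (Fin 2) (ZMod (p ^ t)) //
    x.transpose * S.map (PadicInt.toZModPow t) * x = T.map (PadicInt.toZModPow t)}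

/-- The normalised number of solutions `(p^t)^{-(2m-3)} · #{x mod p^t : ᵗx S x ≡ T mod p^t}`, with
`m` the size of `S`; its limit as `t → ∞` is the local density of representing `T` by `S`. -/
noncomputable def densityApprox {p : ℕ} [Fact p.Prime] {ι : Type} [Fintype ι]
    (S : Matrix ι ι ℤ_[p]) (T : Matrix (Fin 2) (Fin 2) ℤ_[p]) (t : ℕ) : ℂ :=
  (repCount S T t : ℂ) * ((p : ℂ) ^ t) ^ 3 / ((p : ℂ) ^ t) ^ (2 * Fintype.card ι)

/-- `f` is the representation density `α_p(X, T, S)` as a power series in `X`: for all large `r`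
it converges at `X = p^{-r}`, and its value there is the local density of representing `T` by
`S ⊥ H^r`. (For singular `T` the density need not exist for small `r`.) -/
def IsRepDensity {p : ℕ} [Fact p.Prime] {ι : Type} [Fintype ι]
    (S : Matrix ι ι ℤ_[p]) (T : Matrix (Fin 2) (Fin 2) ℤ_[p]) (f : ℂ⟦X⟧) : Prop :=
  ∀ᶠ r : ℕ in Filter.atTop, ∃ a : ℂ,
    HasSum (fun k : ℕ => PowerSeries.coeff k f * (((p : ℂ) ^ r)⁻¹) ^ k) a ∧
    Filter.Tendsto (fun t : ℕ => densityApprox (addHyperbolic S r) T t) Filter.atTop (nhds a)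

/-- `P` is the representation density polynomial `α_p(X, T, S)`: for every `r ≥ 0`, its value at
`X = p^{-r}` is the local density of representing `T` by `S ⊥ H^r`. -/
def IsRepDensityPolynomial {p : ℕ} [Fact p.Prime] {ι : Type} [Fintype ι]
    (S : Matrix ι ι ℤ_[p]) (T : Matrix (Fin 2) (Fin 2) ℤ_[p]) (P : Polynomial ℂ) : Prop :=
  ∀ r : ℕ, Filter.Tendsto (fun t : ℕ => densityApprox (addHyperbolic S r) T t) Filter.atTop
    (nhds (P.eval ((p : ℂ) ^ r)⁻¹))

open Classical in
/-- The sum, over the classes `b = p^{-k} B` in `Sym_2(ℚ_p) / Sym_2(ℤ_p)` that are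
`GL_2(ℤ_p)`-equivalent to `diag(u p^{-k}, 0)` with `u` a unit (that is, `B ∈ Sym_2(ℤ/p^k)` has a
unit entry and determinant `0`), of
`∫ ψ(tr b (ᵗx S x - T)) dx`, the integral being over `x ∈ M_{m,2}(ℤ_p)`. -/
noncomputable def yangR1Coeff {p : ℕ} [Fact p.Prime] {ι : Type} [Fintype ι]
    (S : Matrix ι ι ℤ_[p]) (T : Matrix (Fin 2) (Fin 2) ℤ_[p]) (k : ℕ) : ℂ :=
  ∑ B : Matrix (Fin 2) (Fin 2) (ZMod (p ^ k)) with
      B.IsSymm ∧ (∃ i j, IsUnit (B i j)) ∧ B.det = 0,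
    (((p : ℂ) ^ k) ^ (2 * Fintype.card ι))⁻¹ *
      ∑ x : Matrix ι (Fin 2) (ZMod (p ^ k)),
        ZMod.stdAddChar (B * (x.transpose * S.map (PadicInt.toZModPow k) * x
          - T.map (PadicInt.toZModPow k))).trace

/-- The part `R_1(X, T, S)` in the decomposition `α_p(X, T, S) = 1 + R_1(X, T, S) + R_2(X, T, S)`.
Expand the local density as an integral over `b ∈ Sym_2(ℚ_p)`; the term `1` comes from integral
`b`, and `R_1` (resp. `R_2`) from the `b` with exactly one (resp. two) non-integral elementary
divisors. A `b` with elementary divisors `p^{-k}, 1`, `k ≥ 1`, contributes to `X^k`. -/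
noncomputable def yangR1 {p : ℕ} [Fact p.Prime] {ι : Type} [Fintype ι]
    (S : Matrix ι ι ℤ_[p]) (T : Matrix (Fin 2) (Fin 2) ℤ_[p]) : ℂ⟦X⟧ :=
  PowerSeries.mk fun k => if k = 0 then 0 else yangR1Coeff S T k

/-- The `ℤ_p`-lattice of matrices `(a, b/N; c, -a)` with `a, b, c ∈ ℤ_p`. -/
noncomputable def latticeCalL (p : ℕ) [Fact p.Prime] (N : ℕ) :
    Submodule ℤ_[p] (Matrix (Fin 2) (Fin 2) ℚ_[p]) where
  carrier := {x | ∃ a b c : ℤ_[p], x = !![(a : ℚ_[p]), (b : ℚ_[p]) / N; (c : ℚ_[p]), -(a : ℚ_[p])]}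
  add_mem' := by
    rintro _ _ ⟨a, b, c, rfl⟩ ⟨a', b', c', rfl⟩
    refine ⟨a + a', b + b', c + c', ?_⟩
    ext i j
    fin_cases i <;> fin_cases j <;> simp <;> ring
  zero_mem' := ⟨0, 0, 0, by ext i j; fin_cases i <;> fin_cases j <;> simp⟩
  smul_mem' := by
    rintro s _ ⟨a, b, c, rfl⟩
    refine ⟨s * a, s * b, s * c, ?_⟩
    ext i j
    fin_cases i <;> fin_cases j <;> simp [Algebra.smul_def] <;> ring

/-- The lattice `L_0 = M_2(ℤ_p)^{tr = 0}`, inside `M_2(ℚ_p)`. -/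
noncomputable def latticeL0 (p : ℕ) [Fact p.Prime] :
    Submodule ℤ_[p] (Matrix (Fin 2) (Fin 2) ℚ_[p]) where
  carrier := {x | x.trace = 0 ∧ ∀ i j, ∃ z : ℤ_[p], x i j = z}
  add_mem' := by
    rintro x y ⟨hx, hx'⟩ ⟨hy, hy'⟩
    refine ⟨by rw [Matrix.trace_add, hx, hy, add_zero], fun i j => ?_⟩
    obtain ⟨z, hz⟩ := hx' i j
    obtain ⟨w, hw⟩ := hy' i j
    exact ⟨z + w, by simp [hz, hw]⟩
  zero_mem' := ⟨by simp, fun i j => ⟨0, by simp⟩⟩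
  smul_mem' := by
    rintro s x ⟨hx, hx'⟩
    refine ⟨by rw [Matrix.trace_smul, hx, smul_zero], fun i j => ?_⟩
    obtain ⟨z, hz⟩ := hx' i j
    exact ⟨s * z, by simp [hz, Algebra.smul_def]⟩

/-- `S` is the Gram matrix, in some `ℤ_p`-basis `e` of the rank three lattice `L`, of the quadratic
form `Q`, with entries `(Q(e_i + e_j) - Q(e_i) - Q(e_j)) / 2`, so that `Q(e_i)` is on the
diagonal. -/
def IsGramMatrix {p : ℕ} [Fact p.Prime] (Q : Matrix (Fin 2) (Fin 2) ℚ_[p] → ℚ_[p])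
    (L : Submodule ℤ_[p] (Matrix (Fin 2) (Fin 2) ℚ_[p])) (S : Matrix (Fin 3) (Fin 3) ℤ_[p]) :
    Prop :=
  ∃ e : Module.Basis (Fin 3) ℤ_[p] L, ∀ i j : Fin 3,
    ((S i j : ℤ_[p]) : ℚ_[p]) =
      QuadraticMap.polar Q (e i : Matrix (Fin 2) (Fin 2) ℚ_[p]) (e j) / 2

/-! Fourier inversion on `Sym_2(ℤ/p^t)` turns the solution count into a sum of local integrals
`charMean` over classes b = p^{-k}B. Sorted by exact level k, only primitive B occur
(`sum_isSymm_charMean`). Each hyperbolic plane multiplies the term of B by p^{-e}, where e =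
`denomExp B` (`hyperbolicMean_eq`), so adding H^r means putting X = p^{-r} in the sum of `charMean`
· X^e. As e ≥ k, each coefficient is a finite sum; crude bounds give convergence for r ≥ 6, and
uniqueness follows because the points p^{-r} accumulate at 0. If det T ≠ 0, high levels vanish
(`levelPoly_eq_zero`), which gives polynomials valid for all r.

For the identity, both lattices have the form ⟨ε⟩ ⊥ H, with ε = -N and ε = -1. Writing X = py
cancels the factor of this H and leaves the binary Gauss integrals `gaussMean`. The key relation is
`sum_isSymm_comp_reduceHom_mul_gaussMean`: for a unit ε, summing over the lifts C of B from level k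
to level k+1 kills every x outside p(ℤ/p^(k+1))², and what remains is p times the Gauss integral of
B at level k with parameter pε. Thus level k of 𝓛 and T corresponds to level k+1 of L₀ and NT, the
unit N/p being absorbed by scaling B.

Under this correspondence e(C) - e(B) is 2 if det C ≠ 0, whence X^{-2}, but only 1 if det C = 0. The
singular C therefore need the correction (X - p)R_1 (`levelPoly_eval_relation`). The lowest levels
are computed over 𝔽_p and account for (X + p)/p. -/

section Characters

/-! ### Reduction between ℤ/p^(k+1) and ℤ/p^k, and additive characters. -/

variable {p : ℕ} [Fact p.Prime]

/-- Reduction `ℤ/p^(k+1) → ℤ/p^k`. -/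
abbrev reduceHom (p k : ℕ) : ZMod (p ^ (k + 1)) →+* ZMod (p ^ k) :=
  ZMod.castHom (pow_dvd_pow p k.le_succ) (ZMod (p ^ k))

theorem reduceHom_surjective (p k : ℕ) : Function.Surjective (reduceHom p k) :=
  ZMod.castHom_surjective _

/-- For an integer lift n of z, both sides are exp(2πi n/p^k). -/
theorem stdAddChar_prime_mul (k : ℕ) (z : ZMod (p ^ (k + 1))) :
    ZMod.stdAddChar ((p : ZMod (p ^ (k + 1))) * z) = ZMod.stdAddChar (reduceHom p k z) := by
  obtain ⟨n, rfl⟩ := ZMod.intCast_surjective z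
  have hp : (p : ℂ) ≠ 0 := Nat.cast_ne_zero.2 (Fact.out : p.Prime).ne_zero
  have h1 : (p : ZMod (p ^ (k + 1))) * (n : ZMod (p ^ (k + 1))) = ((p * n : ℤ) : ZMod _) := by
    push_cast; rfl
  rw [h1, map_intCast (reduceHom p k), ZMod.stdAddChar_coe, ZMod.stdAddChar_coe]
  congr 1
  push_cast
  field_simp
  ring

theorem prime_mul_eq_zero_iff (k : ℕ) (z : ZMod (p ^ (k + 1))) :
    (p : ZMod (p ^ (k + 1))) * z = 0 ↔ reduceHom p k z = 0 := by
  obtain ⟨n, rfl⟩ := ZMod.intCast_surjective z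
  have h1 : (p : ZMod (p ^ (k + 1))) * (n : ZMod (p ^ (k + 1))) = ((p * n : ℤ) : ZMod _) := by
    push_cast; rfl
  rw [h1, map_intCast, ZMod.intCast_zmod_eq_zero_iff_dvd, ZMod.intCast_zmod_eq_zero_iff_dvd]
  push_cast
  rw [pow_succ', mul_dvd_mul_iff_left]
  exact_mod_cast (Fact.out : p.Prime).ne_zero

theorem isUnit_zmod_iff (k : ℕ) (hk : k ≠ 0) (z : ZMod (p ^ k)) :
    IsUnit z ↔ ¬ (p : ZMod (p ^ k)) ∣ z := by
  have hpr : p.Prime := Fact.out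
  obtain ⟨n, rfl⟩ := ZMod.natCast_zmod_surjective z
  rw [ZMod.isUnit_iff_coprime, Nat.coprime_pow_right_iff (Nat.pos_of_ne_zero hk), Nat.coprime_comm,
    hpr.coprime_iff_not_dvd, not_iff_not]
  constructor
  · rintro ⟨m, rfl⟩
    exact ⟨m, by push_cast; rfl⟩
  · rintro ⟨m, hm⟩
    obtain ⟨m, rfl⟩ := ZMod.natCast_zmod_surjective m
    rw [← Nat.cast_mul, ZMod.natCast_eq_natCast_iff] at hm
    exact ((hm.of_dvd (dvd_pow_self p hk)).dvd_iff dvd_rfl).2 (dvd_mul_right _ _)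

theorem isUnit_reduceHom_iff (k : ℕ) (hk : k ≠ 0) (z : ZMod (p ^ (k + 1))) :
    IsUnit (reduceHom p k z) ↔ IsUnit z := by
  obtain ⟨n, rfl⟩ := ZMod.natCast_zmod_surjective z
  rw [map_natCast, ZMod.isUnit_iff_coprime, ZMod.isUnit_iff_coprime,
    Nat.coprime_pow_right_iff (Nat.pos_of_ne_zero hk), Nat.coprime_pow_right_iff k.succ_pos]

theorem isUnit_two_zmod (hp2 : p ≠ 2) (k : ℕ) : IsUnit (2 : ZMod (p ^ k)) := by
  have := (ZMod.isUnit_iff_coprime 2 (p ^ k)).2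
    (Nat.Coprime.pow_right k ((Nat.coprime_primes Nat.prime_two Fact.out).2 (Ne.symm hp2)))
  exact_mod_cast this

theorem isUnit_two_padicInt (hp2 : p ≠ 2) : IsUnit (2 : ℤ_[p]) := by
  rw [PadicInt.isUnit_iff]
  have := (PadicInt.norm_natCast_eq_one_iff (p := p) (n := 2)).2
    ((Nat.coprime_primes Fact.out Nat.prime_two).2 hp2)
  exact_mod_cast this

end Characters

/-! ### Orthogonality of characters on matrices over ℤ/n. -/

section FiniteSums

theorem card_mul_sum_comp_surjective {G H : Type*} [AddGroup G] [AddGroup H] [Fintype G]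
    [Fintype H] (φ : G →+ H) (hφ : Function.Surjective φ) (f : H → ℂ) :
    (Fintype.card H : ℂ) * ∑ x, f (φ x) = Fintype.card G * ∑ y, f y := by
  classical
  have key : ∀ y, (Fintype.card {x // φ x = y}) = Fintype.card φ.ker := by
    intro y
    obtain ⟨x₀, rfl⟩ := hφ y
    refine Fintype.card_congr ⟨fun x => ⟨x.1 - x₀, ?_⟩, fun x => ⟨x.1 + x₀, ?_⟩, ?_, ?_⟩
    · rw [AddMonoidHom.mem_ker, map_sub, x.2, sub_self]
    · rw [map_add, x.2, zero_add]
    · intro x; simp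
    · intro x; simp
  have h1 : ∑ x, f (φ x) = ∑ y, (Fintype.card φ.ker : ℂ) * f y := by
    rw [← Fintype.sum_fiberwise φ]
    refine Finset.sum_congr rfl fun y _ => ?_
    rw [Finset.sum_congr rfl (fun x _ => by rw [x.2]), Finset.sum_const, Finset.card_univ, key y,
      nsmul_eq_mul]
  have h2 : Fintype.card G = Fintype.card φ.ker * Fintype.card H := by
    rw [← Fintype.card_congr (Equiv.sigmaFiberEquiv φ), Fintype.card_sigma,
      Finset.sum_congr rfl (fun y _ => key y), Finset.sum_const, Finset.card_univ, smul_eq_mul,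
      mul_comm]
  rw [h1, ← Finset.mul_sum, h2]
  push_cast
  ring

theorem sum_isSymm_eq {R : Type*} [Fintype R] [DecidableEq R]
    [DecidablePred (Matrix.IsSymm : Matrix (Fin 2) (Fin 2) R → Prop)]
    (f : Matrix (Fin 2) (Fin 2) R → ℂ) :
    ∑ B : Matrix (Fin 2) (Fin 2) R with B.IsSymm, f B = ∑ a, ∑ b, ∑ d, f !![a, b; b, d] := by
  simp only [← Fintype.sum_prod_type']
  symm
  refine Finset.sum_bij (fun (x : R × R × R) _ => !![x.1, x.2.1; x.2.1, x.2.2]) ?_ ?_ ?_ ?_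
  · intro x _
    simp only [Finset.mem_filter, Finset.mem_univ, true_and]
    ext i j
    fin_cases i <;> fin_cases j <;> rfl
  · rintro ⟨a, b, d⟩ _ ⟨a', b', d'⟩ _ h
    have h00 := congrFun (congrFun h 0) 0
    have h01 := congrFun (congrFun h 0) 1
    have h11 := congrFun (congrFun h 1) 1
    simp at h00 h01 h11
    simp [h00, h01, h11]
  · intro B hB
    simp only [Finset.mem_filter, Finset.mem_univ, true_and] at hB
    refine ⟨(B 0 0, B 0 1, B 1 1), Finset.mem_univ _, ?_⟩
    ext i j
    fin_cases i <;> fin_cases j <;> simp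
    exact (hB.apply 0 1).symm
  · intros; rfl

theorem sum_addChar_mul {n : ℕ} [NeZero n] (b : ZMod n) :
    ∑ x : ZMod n, ZMod.stdAddChar (x * b) = if b = 0 then (n : ℂ) else 0 := by
  rw [AddChar.sum_mulShift b (ZMod.isPrimitive_stdAddChar n), ZMod.card]
  split_ifs <;> simp

/-- The off-diagonal entry of B occurs twice in the trace and is paired with 2 Y₀₁, so 2 has to be a
unit for the sum to detect Y = 0. -/
theorem sum_isSymm_stdAddChar_trace {n : ℕ} [NeZero n] (h2 : IsUnit (2 : ZMod n))
    [DecidablePred (Matrix.IsSymm : Matrix (Fin 2) (Fin 2) (ZMod n) → Prop)]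
    (Y : Matrix (Fin 2) (Fin 2) (ZMod n)) (hY : Y.IsSymm) [Decidable (Y = 0)] :
    ∑ B : Matrix (Fin 2) (Fin 2) (ZMod n) with B.IsSymm, ZMod.stdAddChar (B * Y).trace =
      if Y = 0 then (n : ℂ) ^ 3 else 0 := by
  rw [sum_isSymm_eq]
  have h01 : Y 1 0 = Y 0 1 := hY.apply 0 1
  have h : ∀ a b d : ZMod n, ZMod.stdAddChar ((!![a, b; b, d] * Y).trace) =
      ZMod.stdAddChar (a * Y 0 0) * ZMod.stdAddChar (b * (2 * Y 0 1)) *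
        ZMod.stdAddChar (d * Y 1 1) := by
    intro a b d
    rw [← AddChar.map_add_eq_mul, ← AddChar.map_add_eq_mul]
    congr 1
    simp only [Matrix.trace, Matrix.diag, Fin.sum_univ_two, Matrix.mul_apply, Matrix.of_apply,
      Matrix.cons_val_zero, Matrix.cons_val_one, h01]
    ring
  simp only [h, ← Finset.mul_sum, ← Finset.sum_mul, sum_addChar_mul]
  have h3 : Y = 0 ↔ Y 0 0 = 0 ∧ 2 * Y 0 1 = 0 ∧ Y 1 1 = 0 := by
    rw [h2.mul_right_eq_zero]
    constructor
    · rintro rfl; simp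
    · rintro ⟨h, h', h''⟩
      ext i j
      fin_cases i <;> fin_cases j <;> simp [h, h', h'', h01]
  by_cases h0 : Y 0 0 = 0 <;> by_cases h1 : 2 * Y 0 1 = 0 <;> by_cases h4 : Y 1 1 = 0 <;>
    simp [h3, h0, h1, h4]
  ring

theorem sum_matrix_stdAddChar_trace {n : ℕ} [NeZero n] (Y : Matrix (Fin 2) (Fin 2) (ZMod n))
    (hY : Y ≠ 0) :
    ∑ B : Matrix (Fin 2) (Fin 2) (ZMod n), ZMod.stdAddChar (B * Y).trace = 0 := by
  obtain ⟨i, j, hij⟩ : ∃ i j, Y i j ≠ 0 := by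
    by_contra! h
    exact hY (by ext i j; exact h i j)
  let ψ : AddChar (Matrix (Fin 2) (Fin 2) (ZMod n)) ℂ :=
    { toFun := fun B => ZMod.stdAddChar (B * Y).trace
      map_zero_eq_one' := by simp
      map_add_eq_mul' := fun a b => by
        rw [add_mul, Matrix.trace_add, AddChar.map_add_eq_mul] }
  refine (AddChar.sum_eq_zero_iff_ne_zero (ψ := ψ)).2 fun h => ?_
  refine hij ?_
  have h1 : ∀ z : ZMod n, ZMod.stdAddChar (z * Y i j) = (1 : ℂ) := by
    intro z
    have := DFunLike.congr_fun h (Matrix.single j i z)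
    simpa [ψ, Matrix.trace_single_mul] using this
  by_contra h0
  have := sum_addChar_mul (Y i j)
  rw [if_neg h0, Finset.sum_congr rfl (fun z _ => h1 z)] at this
  simp [NeZero.ne n] at this

end FiniteSums

/-! ### Fourier expansion of the density, sorted by exact level. -/

section LocalIntegrals

variable {p : ℕ} [Fact p.Prime]

theorem prime_mul_eq_prime_mul_iff (k : ℕ) (z w : ZMod (p ^ (k + 1))) :
    (p : ZMod (p ^ (k + 1))) * z = p * w ↔ reduceHom p k z = reduceHom p k w := by
  rw [← sub_eq_zero, ← mul_sub, prime_mul_eq_zero_iff, map_sub, sub_eq_zero]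

open Classical in
/-- The integral `∫ ψ(tr b (ᵗx S x - T)) dx` over `x ∈ M_{m,2}(ℤ_p)`, for `b = p^{-k} B`. -/
noncomputable def charMean {ι : Type} [Fintype ι] (S : Matrix ι ι ℤ_[p])
    (T : Matrix (Fin 2) (Fin 2) ℤ_[p]) (k : ℕ) (B : Matrix (Fin 2) (Fin 2) (ZMod (p ^ k))) : ℂ :=
  (((p : ℂ) ^ k) ^ (2 * Fintype.card ι))⁻¹ *
    ∑ x : Matrix ι (Fin 2) (ZMod (p ^ k)),
      ZMod.stdAddChar (B * (x.transpose * S.map (PadicInt.toZModPow k) * x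
        - T.map (PadicInt.toZModPow k))).trace

open Classical in
/-- The symmetric matrices over `ℤ/p^k` that have a unit entry. -/
noncomputable def primitiveSymm (p : ℕ) [Fact p.Prime] (k : ℕ) :
    Finset (Matrix (Fin 2) (Fin 2) (ZMod (p ^ k))) :=
  {B | B.IsSymm ∧ ∃ i j, IsUnit (B i j)}

/-- The exponent `w` for which `δ ∈ ℤ/p^k` has additive order `p^w`. -/
noncomputable def logOrder {k : ℕ} (δ : ZMod (p ^ k)) : ℕ := Nat.log p (addOrderOf δ)

/-- For primitive `B`, the sum of the exponents in the denominators of `p^{-k} B`. -/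
noncomputable def denomExp {k : ℕ} (B : Matrix (Fin 2) (Fin 2) (ZMod (p ^ k))) : ℕ :=
  k + logOrder B.det

theorem addOrderOf_eq_pow_logOrder {k : ℕ} (δ : ZMod (p ^ k)) :
    addOrderOf δ = p ^ logOrder δ := by
  have hpr : p.Prime := Fact.out
  have h : addOrderOf δ ∣ p ^ k := by
    have := addOrderOf_dvd_card (x := δ)
    rwa [ZMod.card] at this
  obtain ⟨w, -, hw⟩ := (Nat.dvd_prime_pow hpr).1 h
  rw [logOrder, hw, Nat.log_pow hpr.one_lt]

theorem logOrder_le {k : ℕ} (δ : ZMod (p ^ k)) : logOrder δ ≤ k := by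
  have hpr : p.Prime := Fact.out
  have h : addOrderOf δ ∣ p ^ k := by
    have := addOrderOf_dvd_card (x := δ)
    rwa [ZMod.card] at this
  rw [addOrderOf_eq_pow_logOrder] at h
  exact (Nat.pow_dvd_pow_iff_le_right hpr.one_lt).1 h

theorem logOrder_eq_zero_iff {k : ℕ} (δ : ZMod (p ^ k)) : logOrder δ = 0 ↔ δ = 0 := by
  have hpr : p.Prime := Fact.out
  rw [← AddMonoid.addOrderOf_eq_one_iff (x := δ), addOrderOf_eq_pow_logOrder δ]
  constructor
  · intro h; rw [h, pow_zero]
  · intro h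
    exact (Nat.pow_eq_one.1 h).resolve_left hpr.one_lt.ne'

/-- The annihilator is the kernel of multiplication by δ, whose image, the ideal (δ), is the cyclic
subgroup generated by δ. -/
theorem card_annihilator_mul {k : ℕ} (δ : ZMod (p ^ k)) :
    Nat.card {y : ZMod (p ^ k) // δ * y = 0} * p ^ logOrder δ = p ^ k := by
  rw [← addOrderOf_eq_pow_logOrder]
  have h1 := AddSubgroup.card_mul_index (AddMonoidHom.mulLeft δ).ker
  rw [AddSubgroup.index_ker, Nat.card_zmod] at h1
  have h2 : (AddMonoidHom.mulLeft δ).range = AddSubgroup.zmultiples δ := by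
    ext z
    rw [AddMonoidHom.mem_range, AddSubgroup.mem_zmultiples_iff]
    constructor
    · rintro ⟨y, rfl⟩
      obtain ⟨n, rfl⟩ := ZMod.intCast_surjective y
      exact ⟨n, by simp [mul_comm]⟩
    · rintro ⟨n, rfl⟩
      exact ⟨n, by simp [mul_comm]⟩
  rw [h2, Nat.card_zmultiples] at h1
  exact h1

theorem densityApprox_eq_sum_charMean (hp2 : p ≠ 2) {ι : Type} [Fintype ι]
    (S : Matrix ι ι ℤ_[p]) (hS : S.IsSymm) (T : Matrix (Fin 2) (Fin 2) ℤ_[p]) (hT : T.IsSymm)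
    [∀ t, DecidablePred (Matrix.IsSymm : Matrix (Fin 2) (Fin 2) (ZMod (p ^ t)) → Prop)] (t : ℕ) :
    densityApprox S T t =
      ∑ B : Matrix (Fin 2) (Fin 2) (ZMod (p ^ t)) with B.IsSymm, charMean S T t B := by
  classical
  have hsym : ∀ x : Matrix ι (Fin 2) (ZMod (p ^ t)),
      (x.transpose * S.map (PadicInt.toZModPow t) * x - T.map (PadicInt.toZModPow t)).IsSymm := by
    intro x
    refine Matrix.IsSymm.sub ?_ (hT.map _)
    have := hS.map (PadicInt.toZModPow t)
    rw [Matrix.IsSymm, Matrix.transpose_mul, Matrix.transpose_mul, Matrix.transpose_transpose,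
      this.eq, Matrix.mul_assoc]
  simp only [charMean, ← Finset.mul_sum]
  rw [Finset.sum_comm]
  have h : ∀ x : Matrix ι (Fin 2) (ZMod (p ^ t)),
      ∑ B : Matrix (Fin 2) (Fin 2) (ZMod (p ^ t)) with B.IsSymm, ZMod.stdAddChar
        (B * (x.transpose * S.map (PadicInt.toZModPow t) * x
          - T.map (PadicInt.toZModPow t))).trace =
      ((p : ℂ) ^ t) ^ 3 * if x.transpose * S.map (PadicInt.toZModPow t) * x
          = T.map (PadicInt.toZModPow t) then 1 else 0 := by
    intro x
    rw [sum_isSymm_stdAddChar_trace (isUnit_two_zmod hp2 t) _ (hsym x)]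
    simp only [sub_eq_zero]
    split_ifs <;> simp
  rw [Finset.sum_congr rfl fun x _ => h x, ← Finset.mul_sum, Finset.sum_boole, densityApprox,
    repCount, Nat.card_eq_fintype_card, Fintype.card_subtype]
  rw [div_eq_mul_inv]
  ring

/-- As p^{-(k+1)}(pB) = p^{-k}B, the integral depends only on the class b and not on the chosen
denominator. -/
theorem charMean_prime_smul {ι : Type} [Fintype ι] (S : Matrix ι ι ℤ_[p])
    (T : Matrix (Fin 2) (Fin 2) ℤ_[p]) (k : ℕ)
    (B : Matrix (Fin 2) (Fin 2) (ZMod (p ^ (k + 1)))) :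
    charMean S T (k + 1) ((p : ZMod (p ^ (k + 1))) • B) =
      charMean S T k (B.map (reduceHom p k)) := by
  classical
  have hp : (p : ℂ) ≠ 0 := Nat.cast_ne_zero.2 (Fact.out : p.Prime).ne_zero
  have hmap : ∀ (x : Matrix ι (Fin 2) (ZMod (p ^ (k + 1)))),
      ZMod.stdAddChar (((p : ZMod (p ^ (k + 1))) • B) *
        (x.transpose * S.map (PadicInt.toZModPow (k + 1)) * x
        - T.map (PadicInt.toZModPow (k + 1)))).trace =
      ZMod.stdAddChar (B.map (reduceHom p k) *
        ((x.map (reduceHom p k)).transpose * S.map (PadicInt.toZModPow k) * x.map (reduceHom p k)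
        - T.map (PadicInt.toZModPow k))).trace := by
    intro x
    rw [Matrix.smul_mul, Matrix.trace_smul, smul_eq_mul, stdAddChar_prime_mul]
    congr 1
    rw [AddMonoidHom.map_trace (reduceHom p k)]
    have e1 : (S.map (PadicInt.toZModPow (k + 1))).map (reduceHom p k) =
        S.map (PadicInt.toZModPow k) := by
      ext i j; simp
    have e2 : (T.map (PadicInt.toZModPow (k + 1))).map (reduceHom p k) =
        T.map (PadicInt.toZModPow k) := by
      ext i j; simp
    rw [Matrix.map_mul, Matrix.map_sub _ (map_sub _), Matrix.map_mul, Matrix.map_mul, e1, e2,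
      Matrix.transpose_map]
  have hsurj : Function.Surjective
      ((reduceHom p k).toAddMonoidHom.mapMatrix : Matrix ι (Fin 2) (ZMod (p ^ (k + 1))) →+ _) := by
    intro y
    refine ⟨y.map (Function.surjInv (reduceHom_surjective p k)), ?_⟩
    ext i j
    simp [Function.surjInv_eq (reduceHom_surjective p k)]
  have key := card_mul_sum_comp_surjective _ hsurj
    (fun x => ZMod.stdAddChar (B.map (reduceHom p k) *
        (x.transpose * S.map (PadicInt.toZModPow k) * x - T.map (PadicInt.toZModPow k))).trace)
  simp only [charMean]
  rw [Finset.sum_congr rfl fun x _ => hmap x]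
  have hc : ∀ n : ℕ, (Fintype.card (Matrix ι (Fin 2) (ZMod (p ^ n))) : ℂ) =
      ((p : ℂ) ^ n) ^ (2 * Fintype.card ι) := by
    intro n
    have : Fintype.card (Matrix ι (Fin 2) (ZMod (p ^ n))) =
        Nat.card (ι → Fin 2 → ZMod (p ^ n)) := Nat.card_eq_fintype_card.symm
    rw [this, Nat.card_fun, Nat.card_fun, Nat.card_zmod, Nat.card_fin, Nat.card_eq_fintype_card]
    push_cast
    rw [← pow_mul]
  rw [hc, hc] at key
  have h0 : ∀ n : ℕ, ((p : ℂ) ^ n) ^ (2 * Fintype.card ι) ≠ 0 := fun n => by positivity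
  rw [inv_mul_eq_iff_eq_mul₀ (h0 _), mul_left_comm, eq_inv_mul_iff_mul_eq₀ (h0 _)]
  exact key

-- A symmetric matrix without unit entry is pD with D determined modulo p^k, so the non-primitive
-- terms reproduce the sum at level k.
open Classical in
theorem sum_isSymm_charMean_succ {ι : Type} [Fintype ι] (S : Matrix ι ι ℤ_[p])
    (T : Matrix (Fin 2) (Fin 2) ℤ_[p]) (k : ℕ) :
    ∑ B : Matrix (Fin 2) (Fin 2) (ZMod (p ^ (k + 1))) with B.IsSymm, charMean S T (k + 1) B =
      ∑ B : Matrix (Fin 2) (Fin 2) (ZMod (p ^ k)) with B.IsSymm, charMean S T k B +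
      ∑ B ∈ primitiveSymm p (k + 1), charMean S T (k + 1) B := by
  rw [← Finset.sum_filter_add_sum_filter_not _ (fun B => ¬ ∃ i j, IsUnit (B i j)),
    Finset.filter_filter, Finset.filter_filter]
  simp only [not_not]
  congr 1
  symm
  -- Any set-theoretic section will do, since p · s z depends only on z.
  set s := Function.surjInv (reduceHom_surjective p k)
  have hs : ∀ z, reduceHom p k (s z) = z := Function.surjInv_eq (reduceHom_surjective p k)
  have hs' : ∀ z, (p : ZMod (p ^ (k + 1))) * s (reduceHom p k z) = p * z := fun z => by
    rw [prime_mul_eq_prime_mul_iff, hs]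
  refine Finset.sum_bij (fun B _ => (p : ZMod (p ^ (k + 1))) • B.map s) ?_ ?_ ?_ ?_
  · intro B hB
    simp only [Finset.mem_filter, Finset.mem_univ, true_and] at hB ⊢
    refine ⟨(hB.map _).smul _, ?_⟩
    rintro ⟨i, j, h⟩
    exact (isUnit_zmod_iff _ k.succ_ne_zero _).1 h ⟨_, rfl⟩
  · intro B _ B' _ h
    ext i j
    have := congrFun (congrFun h i) j
    simp only [Matrix.smul_apply, Matrix.map_apply, smul_eq_mul, prime_mul_eq_prime_mul_iff,
      hs] at this
    exact this
  · intro C hC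
    simp only [Finset.mem_filter, Finset.mem_univ, true_and, not_exists,
      isUnit_zmod_iff _ k.succ_ne_zero, not_not] at hC
    obtain ⟨hsym, hdiv⟩ := hC
    choose D hD using hdiv
    refine ⟨(Matrix.of D).map (reduceHom p k), ?_, ?_⟩
    · simp only [Finset.mem_filter, Finset.mem_univ, true_and]
      ext i j
      simp only [Matrix.transpose_apply, Matrix.map_apply, Matrix.of_apply]
      rw [← prime_mul_eq_prime_mul_iff, ← hD, ← hD]
      exact hsym.apply i j
    · ext i j
      simp only [Matrix.smul_apply, Matrix.map_apply, smul_eq_mul, Matrix.of_apply]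
      rw [hs', ← hD]
  · intro B _
    rw [charMean_prime_smul]
    congr 1
    ext i j
    simp [hs]

open Classical in
theorem sum_isSymm_charMean {ι : Type} [Fintype ι] (S : Matrix ι ι ℤ_[p])
    (T : Matrix (Fin 2) (Fin 2) ℤ_[p]) (t : ℕ) :
    ∑ B : Matrix (Fin 2) (Fin 2) (ZMod (p ^ t)) with B.IsSymm, charMean S T t B =
      ∑ k ∈ Finset.range (t + 1), ∑ B ∈ primitiveSymm p k, charMean S T k B := by
  induction t with
  | zero =>
    rw [zero_add, Finset.sum_range_one]
    refine Finset.sum_congr ?_ fun _ _ => rfl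
    -- At level 0 the ring is trivial and 0 is a unit, so its only matrix counts as primitive.
    have : Subsingleton (ZMod (p ^ 0)) := by
      rw [pow_zero]; infer_instance
    ext B
    simp only [primitiveSymm, Finset.mem_filter, Finset.mem_univ, true_and]
    exact ⟨fun h => ⟨h, 0, 0, isUnit_of_subsingleton _⟩, fun h => h.1⟩
  | succ t ih => rw [sum_isSymm_charMean_succ, ih, Finset.sum_range_succ _ (t + 1)]

end LocalIntegrals

/-! ### The effect of adding hyperbolic planes. -/

section Hyperbolic

variable {p : ℕ} [Fact p.Prime]

theorem charMean_eq_sum {ι : Type} [Fintype ι] [DecidableEq ι] (S : Matrix ι ι ℤ_[p])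
    (T : Matrix (Fin 2) (Fin 2) ℤ_[p]) (k : ℕ) (B : Matrix (Fin 2) (Fin 2) (ZMod (p ^ k))) :
    charMean S T k B = (((p : ℂ) ^ k) ^ (2 * Fintype.card ι))⁻¹ *
      ∑ x : Matrix ι (Fin 2) (ZMod (p ^ k)),
        ZMod.stdAddChar (B * (x.transpose * S.map (PadicInt.toZModPow k) * x
          - T.map (PadicInt.toZModPow k))).trace := by
  rw [charMean]
  congr!

/-- The integral `∫ ψ(tr b (ᵗy H y)) dy` over `y ∈ M_2(ℤ_p)`, for `b = p^{-k} B` and the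
hyperbolic plane `H`. -/
noncomputable def hyperbolicMean (k : ℕ) (B : Matrix (Fin 2) (Fin 2) (ZMod (p ^ k))) : ℂ :=
  (((p : ℂ) ^ k) ^ 4)⁻¹ * ∑ y : Matrix (Fin 2) (Fin 2) (ZMod (p ^ k)),
    ZMod.stdAddChar (B * (y.transpose * !![0, Ring.inverse 2; Ring.inverse 2, 0] * y)).trace

theorem toZModPow_inverse_two (hp2 : p ≠ 2) (k : ℕ) :
    PadicInt.toZModPow k (Ring.inverse (2 : ℤ_[p])) = Ring.inverse 2 := by
  have h1 : PadicInt.toZModPow k (Ring.inverse (2 : ℤ_[p])) * 2 = 1 := by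
    rw [← map_ofNat (PadicInt.toZModPow (p := p) k) 2, ← map_mul,
      Ring.inverse_mul_cancel _ (isUnit_two_padicInt hp2), map_one]
  calc _ = PadicInt.toZModPow k (Ring.inverse (2 : ℤ_[p])) * (2 * Ring.inverse 2) := by
        rw [Ring.mul_inverse_cancel _ (isUnit_two_zmod hp2 k), mul_one]
    _ = _ := by rw [← mul_assoc, h1, one_mul]

theorem transpose_mul_fromBlocks_blockDiagonal_mul {R : Type*} [CommRing R] {ι : Type} [Fintype ι]
    {r : ℕ} (S : Matrix ι ι R) (H : Matrix (Fin 2) (Fin 2) R)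
    (x : Matrix (ι ⊕ (Fin 2 × Fin r)) (Fin 2) R) :
    x.transpose * Matrix.fromBlocks S 0 0 (Matrix.blockDiagonal fun _ : Fin r => H) * x =
      (x.submatrix Sum.inl id).transpose * S * x.submatrix Sum.inl id +
      ∑ j, (Matrix.of fun i c => x (Sum.inr (i, j)) c).transpose * H *
        Matrix.of fun i c => x (Sum.inr (i, j)) c := by
  ext a b
  simp [Matrix.mul_apply, Matrix.add_apply, Matrix.sum_apply, Fintype.sum_sum_type,
    Fintype.sum_prod_type, Matrix.blockDiagonal_apply, Finset.sum_add_distrib]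

theorem stdAddChar_sum {n : ℕ} [NeZero n] {α : Type*} (s : Finset α) (f : α → ZMod n) :
    (ZMod.stdAddChar (∑ i ∈ s, f i) : ℂ) = ∏ i ∈ s, ZMod.stdAddChar (f i) := by
  classical
  induction s using Finset.induction_on with
  | empty => simp
  | insert a s ha ih =>
    rw [Finset.sum_insert ha, Finset.prod_insert ha, AddChar.map_add_eq_mul, ih]

/-- The quadratic form is an orthogonal sum, so the integrand factors over the blocks. -/
theorem charMean_addHyperbolic (hp2 : p ≠ 2) {ι : Type} [Fintype ι] (S : Matrix ι ι ℤ_[p])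
    (T : Matrix (Fin 2) (Fin 2) ℤ_[p]) (r k : ℕ) (B : Matrix (Fin 2) (Fin 2) (ZMod (p ^ k))) :
    charMean (addHyperbolic S r) T k B = charMean S T k B * hyperbolicMean k B ^ r := by
  classical
  have hmap : (addHyperbolic S r).map (PadicInt.toZModPow k) =
      Matrix.fromBlocks (S.map (PadicInt.toZModPow k)) 0 0
        (Matrix.blockDiagonal fun _ : Fin r => !![0, Ring.inverse 2; Ring.inverse 2, 0]) := by
    rw [addHyperbolic, Matrix.fromBlocks_map, Matrix.blockDiagonal_map]
    · congr 1
      · ext; simp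
      · ext; simp
      · congr 1
        funext _
        ext i j
        fin_cases i <;> fin_cases j <;> simp [toZModPow_inverse_two hp2]
    · exact map_zero _
  let e : Matrix (ι ⊕ (Fin 2 × Fin r)) (Fin 2) (ZMod (p ^ k)) ≃
      Matrix ι (Fin 2) (ZMod (p ^ k)) × (Fin r → Matrix (Fin 2) (Fin 2) (ZMod (p ^ k))) :=
    { toFun := fun x => (x.submatrix Sum.inl id, fun j => Matrix.of fun i c => x (Sum.inr (i, j)) c)
      invFun := fun y => Matrix.of fun i c => Sum.elim (fun i => y.1 i c) (fun i => y.2 i.2 i.1 c) i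
      left_inv := fun x => by
        ext i c
        rcases i with i | i <;> rfl
      right_inv := fun y => rfl }
  have hsum : ∑ x : Matrix (ι ⊕ (Fin 2 × Fin r)) (Fin 2) (ZMod (p ^ k)), ZMod.stdAddChar
      (B * (x.transpose * (addHyperbolic S r).map (PadicInt.toZModPow k) * x
        - T.map (PadicInt.toZModPow k))).trace =
      (∑ x : Matrix ι (Fin 2) (ZMod (p ^ k)),
        ZMod.stdAddChar (B * (x.transpose * S.map (PadicInt.toZModPow k) * x
        - T.map (PadicInt.toZModPow k))).trace) *
      (∑ y : Matrix (Fin 2) (Fin 2) (ZMod (p ^ k)), ZMod.stdAddChar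
        (B * (y.transpose * !![0, Ring.inverse 2; Ring.inverse 2, 0] * y)).trace) ^ r := by
    rw [Fintype.sum_pow, Fintype.sum_mul_sum, ← Fintype.sum_prod_type']
    refine Fintype.sum_equiv e _ _ fun x => ?_
    rw [hmap, transpose_mul_fromBlocks_blockDiagonal_mul, ← stdAddChar_sum,
      ← AddChar.map_add_eq_mul]
    congr 1
    rw [← Matrix.trace_sum, ← Finset.mul_sum, ← Matrix.trace_add, ← mul_add]
    congr 2
    exact (sub_add_eq_add_sub _ _ _).symm
  rw [charMean_eq_sum, charMean_eq_sum, hyperbolicMean, hsum, mul_pow, Fintype.card_sum, Fintype.card_prod,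
    Fintype.card_fin, Fintype.card_fin, mul_mul_mul_comm]
  congr 1
  rw [inv_pow, ← mul_inv, ← pow_mul _ 4, ← pow_add]
  congr 2
  ring

/-- A unit entry eliminates one coordinate; the other is then constrained only by det · y = 0. -/
theorem card_ker_symm_of_isUnit {R : Type*} [CommRing R] {a b d : R}
    (h : IsUnit a ∨ IsUnit b ∨ IsUnit d) :
    Nat.card {y : R × R // a * y.1 + b * y.2 = 0 ∧ b * y.1 + d * y.2 = 0} =
      Nat.card {y : R // (a * d - b * b) * y = 0} := by
  rcases h with ⟨u, rfl⟩ | ⟨u, rfl⟩ | ⟨u, rfl⟩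
  · refine Nat.card_congr ⟨fun y => ⟨y.1.2, ?_⟩, fun y => ⟨(-(u⁻¹ : Rˣ) * b * y.1, y.1), ?_, ?_⟩,
      fun y => ?_, fun y => rfl⟩
    · linear_combination (u : R) * y.2.2 - b * y.2.1
    · linear_combination (-b * y.1) * u.mul_inv
    · linear_combination (u⁻¹ : Rˣ) * y.2 - d * y.1 * u.mul_inv
    · ext
      · simp only
        linear_combination (-(u⁻¹ : Rˣ)) * y.2.1 + y.1.1 * u.mul_inv
      · rfl
  · refine Nat.card_congr ⟨fun y => ⟨y.1.2, ?_⟩, fun y => ⟨(-(u⁻¹ : Rˣ) * d * y.1, y.1), ?_, ?_⟩,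
      fun y => ?_, fun y => rfl⟩
    · linear_combination a * y.2.2 - (u : R) * y.2.1
    · linear_combination (-(u⁻¹ : Rˣ)) * y.2 - u * y.1 * u.mul_inv
    · linear_combination (-d * y.1) * u.mul_inv
    · ext
      · simp only
        linear_combination (-(u⁻¹ : Rˣ)) * y.2.2 + y.1.1 * u.mul_inv
      · rfl
  · refine Nat.card_congr ⟨fun y => ⟨y.1.1, ?_⟩, fun y => ⟨(y.1, -(u⁻¹ : Rˣ) * b * y.1), ?_, ?_⟩,
      fun y => ?_, fun y => rfl⟩
    · linear_combination (u : R) * y.2.1 - b * y.2.2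
    · linear_combination (u⁻¹ : Rˣ) * y.2 - a * y.1 * u.mul_inv
    · linear_combination (-b * y.1) * u.mul_inv
    · ext
      · rfl
      · simp only
        linear_combination (-(u⁻¹ : Rˣ)) * y.2.2 + y.1.2 * u.mul_inv

theorem sum_matrix_two {R : Type*} [Fintype R] (f : Matrix (Fin 2) (Fin 2) R → ℂ) :
    ∑ y, f y = ∑ y : R × R, ∑ x : R × R, f !![x.1, x.2; y.1, y.2] := by
  rw [Finset.sum_comm, ← Fintype.sum_prod_type']
  let e : Matrix (Fin 2) (Fin 2) R ≃ (R × R) × (R × R) :=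
    { toFun := fun y => ((y 0 0, y 0 1), (y 1 0, y 1 1))
      invFun := fun x => !![x.1.1, x.1.2; x.2.1, x.2.2]
      left_inv := fun y => by ext i j; fin_cases i <;> fin_cases j <;> rfl
      right_inv := fun x => rfl }
  refine Fintype.sum_equiv e _ _ fun y => ?_
  congr 1
  exact (e.left_inv y).symm

/-- The trace is bilinear in the two rows x, y of the matrix. Summing over x forces By = 0, and the
kernel of B has p^(k-w) elements with w = `logOrder B.det`; dividing p^(2k) p^(k-w) by p^(4k) gives
the value. -/
theorem hyperbolicMean_eq (hp2 : p ≠ 2) {k : ℕ} {B : Matrix (Fin 2) (Fin 2) (ZMod (p ^ k))}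
    (hB : B ∈ primitiveSymm p k) : hyperbolicMean k B = ((p : ℂ) ^ denomExp B)⁻¹ := by
  classical
  simp only [primitiveSymm, Finset.mem_filter, Finset.mem_univ, true_and] at hB
  obtain ⟨hsym, hu⟩ := hB
  have h10 : B 1 0 = B 0 1 := hsym.apply 0 1
  have hp : (p : ℂ) ≠ 0 := Nat.cast_ne_zero.2 (Fact.out : p.Prime).ne_zero
  have hu' : IsUnit (B 0 0) ∨ IsUnit (B 0 1) ∨ IsUnit (B 1 1) := by
    obtain ⟨i, j, h⟩ := hu
    fin_cases i <;> fin_cases j <;> simp_all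
  have hc2 : Ring.inverse (2 : ZMod (p ^ k)) * 2 = 1 :=
    Ring.inverse_mul_cancel _ (isUnit_two_zmod hp2 k)
  have htr : ∀ x y : ZMod (p ^ k) × ZMod (p ^ k),
      ZMod.stdAddChar (B * ((!![x.1, x.2; y.1, y.2]).transpose *
        !![0, Ring.inverse 2; Ring.inverse 2, 0] * !![x.1, x.2; y.1, y.2])).trace =
      ZMod.stdAddChar (x.1 * (B 0 0 * y.1 + B 0 1 * y.2)) *
        ZMod.stdAddChar (x.2 * (B 0 1 * y.1 + B 1 1 * y.2)) := by
    intro x y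
    rw [← AddChar.map_add_eq_mul]
    congr 1
    simp only [Matrix.trace, Matrix.diag, Fin.sum_univ_two, Matrix.mul_apply, Matrix.of_apply,
      Matrix.cons_val_zero, Matrix.cons_val_one, Matrix.transpose_apply, h10, Matrix.cons_val',
      Matrix.cons_val_fin_one]
    linear_combination (x.1 * (B 0 0 * y.1 + B 0 1 * y.2) + x.2 * (B 0 1 * y.1 + B 1 1 * y.2)) * hc2
  have hsum : ∑ y : Matrix (Fin 2) (Fin 2) (ZMod (p ^ k)), ZMod.stdAddChar
      (B * (y.transpose * !![0, Ring.inverse 2; Ring.inverse 2, 0] * y)).trace =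
      ((p : ℂ) ^ k) ^ 2 * Nat.card {y : ZMod (p ^ k) × ZMod (p ^ k) //
        B 0 0 * y.1 + B 0 1 * y.2 = 0 ∧ B 0 1 * y.1 + B 1 1 * y.2 = 0} := by
    rw [sum_matrix_two]
    simp only [htr]
    have h1 : ∀ y : ZMod (p ^ k) × ZMod (p ^ k), ∑ x : ZMod (p ^ k) × ZMod (p ^ k),
        ZMod.stdAddChar (x.1 * (B 0 0 * y.1 + B 0 1 * y.2)) *
        ZMod.stdAddChar (x.2 * (B 0 1 * y.1 + B 1 1 * y.2)) = ((p : ℂ) ^ k) ^ 2 *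
        if B 0 0 * y.1 + B 0 1 * y.2 = 0 ∧ B 0 1 * y.1 + B 1 1 * y.2 = 0 then 1 else 0 := by
      intro y
      rw [Fintype.sum_prod_type]
      simp only [← Finset.mul_sum, ← Finset.sum_mul, sum_addChar_mul]
      by_cases h0 : B 0 0 * y.1 + B 0 1 * y.2 = 0 <;>
        by_cases h1 : B 0 1 * y.1 + B 1 1 * y.2 = 0 <;> simp [h0, h1]
      ring
    rw [Finset.sum_congr rfl fun y _ => h1 y, ← Finset.mul_sum, Finset.sum_boole,
      Nat.card_eq_fintype_card, Fintype.card_subtype]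
  rw [hyperbolicMean, hsum, card_ker_symm_of_isUnit hu', denomExp, Matrix.det_fin_two, h10]
  have h2 := card_annihilator_mul (B 0 0 * B 1 1 - B 0 1 * B 0 1)
  have h3 : (Nat.card {y : ZMod (p ^ k) // (B 0 0 * B 1 1 - B 0 1 * B 0 1) * y = 0} : ℂ) *
      (p : ℂ) ^ logOrder (B 0 0 * B 1 1 - B 0 1 * B 0 1) = (p : ℂ) ^ k := by
    exact_mod_cast h2
  refine eq_inv_of_mul_eq_one_left ?_
  rw [pow_add]
  field_simp
  linear_combination h3

end Hyperbolic

/-! ### Densities as values of level polynomials. -/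

section LevelPolynomials

variable {p : ℕ} [Fact p.Prime]

open Polynomial in
/-- The contribution to `α_p(X, T, S)` of the `b` with largest denominator `p^k`. -/
noncomputable def levelPoly {ι : Type} [Fintype ι] (S : Matrix ι ι ℤ_[p])
    (T : Matrix (Fin 2) (Fin 2) ℤ_[p]) (k : ℕ) : ℂ[X] :=
  ∑ B ∈ primitiveSymm p k, C (charMean S T k B) * X ^ denomExp B

theorem levelPoly_eval {ι : Type} [Fintype ι] (S : Matrix ι ι ℤ_[p])
    (T : Matrix (Fin 2) (Fin 2) ℤ_[p]) (k : ℕ) (z : ℂ) :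
    (levelPoly S T k).eval z = ∑ B ∈ primitiveSymm p k, charMean S T k B * z ^ denomExp B := by
  simp [levelPoly, Polynomial.eval_finsetSum]

theorem addHyperbolic_isSymm {ι : Type} {S : Matrix ι ι ℤ_[p]} (hS : S.IsSymm) (r : ℕ) :
    (addHyperbolic S r).IsSymm := by
  refine Matrix.IsSymm.fromBlocks hS (by simp) ?_
  rw [Matrix.IsSymm, Matrix.blockDiagonal_transpose]
  congr 1
  funext _
  ext i j
  fin_cases i <;> fin_cases j <;> rfl

theorem densityApprox_addHyperbolic (hp2 : p ≠ 2) {ι : Type} [Fintype ι]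
    {S : Matrix ι ι ℤ_[p]} (hS : S.IsSymm) {T : Matrix (Fin 2) (Fin 2) ℤ_[p]} (hT : T.IsSymm)
    (r t : ℕ) :
    densityApprox (addHyperbolic S r) T t =
      ∑ k ∈ Finset.range (t + 1), (levelPoly S T k).eval ((p : ℂ) ^ r)⁻¹ := by
  classical
  rw [densityApprox_eq_sum_charMean hp2 _ (addHyperbolic_isSymm hS r) T hT, sum_isSymm_charMean]
  refine Finset.sum_congr rfl fun k _ => ?_
  rw [levelPoly_eval]
  refine Finset.sum_congr rfl fun B hB => ?_
  rw [charMean_addHyperbolic hp2, hyperbolicMean_eq hp2 hB, inv_pow, inv_pow, ← pow_mul, ← pow_mul,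
    mul_comm r]

end LevelPolynomials

/-! ### Convergence and uniqueness of the density series. -/

section Series

variable {p : ℕ} [Fact p.Prime] {ι : Type} [Fintype ι] (S : Matrix ι ι ℤ_[p])
  (T : Matrix (Fin 2) (Fin 2) ℤ_[p])

theorem norm_charMean_le_one (k : ℕ) (B : Matrix (Fin 2) (Fin 2) (ZMod (p ^ k))) :
    ‖charMean S T k B‖ ≤ 1 := by
  classical
  have hp : 0 < p := (Fact.out : p.Prime).pos
  have hc : (Fintype.card (Matrix ι (Fin 2) (ZMod (p ^ k))) : ℝ) =
      ((p : ℝ) ^ k) ^ (2 * Fintype.card ι) := by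
    have : Fintype.card (Matrix ι (Fin 2) (ZMod (p ^ k))) =
        Nat.card (ι → Fin 2 → ZMod (p ^ k)) := Nat.card_eq_fintype_card.symm
    rw [this, Nat.card_fun, Nat.card_fun, Nat.card_zmod, Nat.card_fin, Nat.card_eq_fintype_card]
    push_cast
    rw [← pow_mul]
  rw [charMean_eq_sum, norm_mul, norm_inv, norm_pow, norm_pow, Complex.norm_natCast,
    inv_mul_le_iff₀ (by positivity), mul_one, ← hc]
  refine (norm_sum_le _ _).trans ?_
  simp only [AddChar.norm_apply, Finset.sum_const, Finset.card_univ, nsmul_eq_mul, mul_one,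
    le_refl]

theorem coeff_levelPoly_eq_zero {k n : ℕ} (h : n < k) : (levelPoly S T k).coeff n = 0 := by
  rw [levelPoly, Polynomial.finsetSum_coeff]
  refine Finset.sum_eq_zero fun B _ => ?_
  rw [Polynomial.coeff_C_mul_X_pow, if_neg]
  rw [denomExp]
  omega

theorem norm_coeff_levelPoly_le (k n : ℕ) :
    ‖(levelPoly S T k).coeff n‖ ≤ ((p : ℝ) ^ k) ^ 4 := by
  rw [levelPoly, Polynomial.finsetSum_coeff]
  have h1 : ∀ B ∈ primitiveSymm p k,
      ‖(Polynomial.C (charMean S T k B) * Polynomial.X ^ denomExp B).coeff n‖ ≤ 1 := by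
    intro B _
    rw [Polynomial.coeff_C_mul_X_pow]
    split_ifs
    · exact norm_charMean_le_one S T k B
    · simp
  refine (norm_sum_le_of_le _ h1).trans ?_
  rw [Finset.sum_const, nsmul_eq_mul, mul_one]
  have h2 : (primitiveSymm p k).card ≤ (p ^ k) ^ 4 := by
    refine (Finset.card_le_univ _).trans_eq ?_
    have : Fintype.card (Matrix (Fin 2) (Fin 2) (ZMod (p ^ k))) =
        Nat.card (Fin 2 → Fin 2 → ZMod (p ^ k)) := Nat.card_eq_fintype_card.symm
    rw [this, Nat.card_fun, Nat.card_fun, Nat.card_zmod, Nat.card_fin, ← pow_mul]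
  exact_mod_cast h2

/-- The representation density `α_p(X, T, S)`. -/
noncomputable def repSeries : ℂ⟦X⟧ :=
  PowerSeries.mk fun n => ∑ k ∈ Finset.range (n + 1), (levelPoly S T k).coeff n

theorem norm_coeff_levelPoly_mul_le {r : ℕ} (hr : 6 ≤ r) (k n : ℕ) :
    ‖(levelPoly S T k).coeff n * (((p : ℂ) ^ r)⁻¹) ^ n‖ ≤ ((p : ℝ)⁻¹) ^ k * ((p : ℝ)⁻¹) ^ n := by
  have hp : (1 : ℝ) ≤ p := by exact_mod_cast (Fact.out : p.Prime).one_le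
  rcases lt_or_ge n k with h | h
  · rw [coeff_levelPoly_eq_zero S T h, zero_mul, norm_zero]
    positivity
  · rw [norm_mul, norm_pow, norm_inv, norm_pow, Complex.norm_natCast]
    calc _ ≤ ((p : ℝ) ^ k) ^ 4 * (((p : ℝ) ^ r)⁻¹) ^ n := by
          gcongr
          exact norm_coeff_levelPoly_le S T k n
      _ ≤ _ := by
          rw [inv_pow, inv_pow, inv_pow, ← div_eq_mul_inv, ← mul_inv, div_le_iff₀ (by positivity),
            le_inv_mul_iff₀ (by positivity), ← pow_mul, ← pow_add, ← pow_add, ← pow_mul]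
          -- Since k ≤ n, the exponents satisfy 4k + k + n ≤ 6n ≤ rn.
          exact pow_le_pow_right₀ hp (by nlinarith)

/-- The double family indexed by level and degree is absolutely summable. Summed by degree it is the
power series; summed by level it is the limit of the densities. -/
theorem exists_hasSum_repSeries {r : ℕ} (hr : 6 ≤ r) :
    ∃ a : ℂ, HasSum (fun n => PowerSeries.coeff n (repSeries S T) * (((p : ℂ) ^ r)⁻¹) ^ n) a ∧
      HasSum (fun k => (levelPoly S T k).eval ((p : ℂ) ^ r)⁻¹) a := by
  have hp : (1 : ℝ) < p := by exact_mod_cast (Fact.out : p.Prime).one_lt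
  have hgeo : Summable fun k : ℕ => ((p : ℝ)⁻¹) ^ k :=
    summable_geometric_of_lt_one (by positivity) (inv_lt_one_of_one_lt₀ hp)
  set u : ℕ × ℕ → ℂ := fun x => (levelPoly S T x.1).coeff x.2 * (((p : ℂ) ^ r)⁻¹) ^ x.2
  have hu : Summable u :=
    Summable.of_norm_bounded (hgeo.mul_of_nonneg hgeo (fun _ => by positivity)
      (fun _ => by positivity)) fun x => norm_coeff_levelPoly_mul_le S T hr x.1 x.2
  refine ⟨∑' x, u x, ?_, ?_⟩
  · refine HasSum.prod_fiberwise (f := fun x : ℕ × ℕ => u x.swap)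
      ((Equiv.prodComm ℕ ℕ).hasSum_iff.2 hu.hasSum) fun n => ?_
    rw [repSeries, PowerSeries.coeff_mk, Finset.sum_mul]
    refine hasSum_sum_of_ne_finset_zero fun k hk => ?_
    simp only [u, Prod.swap_prod_mk]
    rw [coeff_levelPoly_eq_zero S T (by simpa using hk), zero_mul]
  · refine HasSum.prod_fiberwise hu.hasSum fun k => ?_
    rw [Polynomial.eval_eq_sum_range]
    refine hasSum_sum_of_ne_finset_zero fun n hn => ?_
    simp only [u]
    rw [Polynomial.coeff_eq_zero_of_natDegree_lt (by simpa using hn), zero_mul]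

variable {S T}

theorem isRepDensity_repSeries (hp2 : p ≠ 2) (hS : S.IsSymm) (hT : T.IsSymm) :
    IsRepDensity S T (repSeries S T) := by
  filter_upwards [Filter.eventually_ge_atTop 6] with r hr
  obtain ⟨a, h1, h2⟩ := exists_hasSum_repSeries S T hr
  refine ⟨a, h1, ?_⟩
  simp only [densityApprox_addHyperbolic hp2 hS hT]
  exact h2.tendsto_sum_nat.comp (Filter.tendsto_add_atTop_nat 1)

/-- Convergence at one nonzero point makes the sum analytic near 0, where its zeros `z r`
accumulate; the identity theorem applies. -/
theorem powerSeries_eq_zero_of_hasSum_zero {h : ℂ⟦X⟧} {z : ℕ → ℂ} (hz : ∀ r, z r ≠ 0)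
    (hz0 : Filter.Tendsto z Filter.atTop (nhds 0))
    (hsum : ∀ᶠ r in Filter.atTop, HasSum (fun n => PowerSeries.coeff n h * z r ^ n) 0) :
    h = 0 := by
  obtain ⟨r₀, hr₀⟩ := hsum.exists
  let q := FormalMultilinearSeries.ofScalars ℂ (fun n => PowerSeries.coeff n h)
  have hqn : ∀ n, ‖q n‖ = ‖PowerSeries.coeff n h‖ := fun n =>
    FormalMultilinearSeries.ofScalars_norm ℂ (fun n => PowerSeries.coeff n h) n
  have hrad : 0 < q.radius := by
    have h1 : (‖z r₀‖₊ : ENNReal) ≤ q.radius := by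
      refine FormalMultilinearSeries.le_radius_of_tendsto (l := 0) q ?_
      have := (tendsto_zero_iff_norm_tendsto_zero.1 hr₀.summable.tendsto_atTop_zero)
      simpa [hqn] using this
    refine lt_of_lt_of_le ?_ h1
    simpa using hz r₀
  have hf : HasFPowerSeriesAt q.sum q 0 := (q.hasFPowerSeriesOnBall hrad).hasFPowerSeriesAt
  have hval : ∀ w, q.sum w = ∑' n, PowerSeries.coeff n h * w ^ n := fun w =>
    (FormalMultilinearSeries.ofScalars_sum_eq (fun n => PowerSeries.coeff n h) w).trans (by simp)
  have hfreq : ∃ᶠ w in nhdsWithin (0 : ℂ) {0}ᶜ, q.sum w = 0 := by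
    refine Filter.Tendsto.frequently (f := z) (l₁ := Filter.atTop) ?_ (p := fun w => q.sum w = 0)
      (Filter.Eventually.frequently ?_)
    · exact tendsto_nhdsWithin_iff.2 ⟨hz0, Filter.Eventually.of_forall hz⟩
    · filter_upwards [hsum] with r hr
      rw [hval, hr.tsum_eq]
  have hq : q = 0 := hf.locally_zero_iff.1
    (hf.analyticAt.frequently_zero_iff_eventually_zero.1 hfreq)
  ext n
  have := hqn n
  rw [hq] at this
  simpa using this.symm

theorem isRepDensity_unique {f g : ℂ⟦X⟧} (hf : IsRepDensity S T f) (hg : IsRepDensity S T g) :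
    f = g := by
  have hp : (1 : ℝ) < p := by exact_mod_cast (Fact.out : p.Prime).one_lt
  have hp0 : (p : ℂ) ≠ 0 := Nat.cast_ne_zero.2 (Fact.out : p.Prime).ne_zero
  refine sub_eq_zero.1 (powerSeries_eq_zero_of_hasSum_zero (z := fun r => ((p : ℂ) ^ r)⁻¹)
    (fun r => by positivity) ?_ ?_)
  · simp only [← inv_pow]
    refine tendsto_pow_atTop_nhds_zero_of_norm_lt_one ?_
    rw [norm_inv, Complex.norm_natCast]
    exact inv_lt_one_of_one_lt₀ hp
  · filter_upwards [hf, hg] with r ⟨a, ha, ha'⟩ ⟨b, hb, hb'⟩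
    have := ha.sub hb
    rw [tendsto_nhds_unique ha' hb', sub_self] at this
    simpa [sub_mul] using this

end Series

/-! ### High levels vanish for nonsingular T. -/

section Vanishing

variable {p : ℕ} [Fact p.Prime]

theorem logOrder_mul_of_isUnit {p k : ℕ} {u : ZMod (p ^ k)} (hu : IsUnit u) (δ : ZMod (p ^ k)) :
    logOrder (u * δ) = logOrder δ := by
  rw [logOrder, logOrder]
  congr 1
  exact addOrderOf_injective (AddMonoidHom.mulLeft u) (fun x y h => hu.mul_left_cancel h) δ

theorem denomExp_conj {k : ℕ} {g h : Matrix (Fin 2) (Fin 2) (ZMod (p ^ k))} (hgh : g * h = 1)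
    (B : Matrix (Fin 2) (Fin 2) (ZMod (p ^ k))) :
    denomExp (g * B * g.transpose) = denomExp B := by
  have hu : IsUnit g.det := IsUnit.of_mul_eq_one h.det (by rw [← Matrix.det_mul, hgh, Matrix.det_one])
  rw [denomExp, denomExp, Matrix.det_mul, Matrix.det_mul, Matrix.det_transpose, mul_right_comm,
    logOrder_mul_of_isUnit (hu.mul hu)]

theorem exists_isUnit_iff {k : ℕ} (hk : k ≠ 0) (B : Matrix (Fin 2) (Fin 2) (ZMod (p ^ k))) :
    (∃ i j, IsUnit (B i j)) ↔ ¬ ∃ D, B = (p : ZMod (p ^ k)) • D := by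
  simp only [isUnit_zmod_iff k hk]
  constructor
  · rintro ⟨i, j, h⟩ ⟨D, rfl⟩
    exact h ⟨D i j, rfl⟩
  · contrapose!
    intro h
    choose D hD using h
    exact ⟨Matrix.of D, by ext i j; exact hD i j⟩

theorem conj_mem_primitiveSymm {k : ℕ} (hk : k ≠ 0) {g h : Matrix (Fin 2) (Fin 2) (ZMod (p ^ k))}
    (hhg : h * g = 1) {B : Matrix (Fin 2) (Fin 2) (ZMod (p ^ k))} (hB : B ∈ primitiveSymm p k) :
    g * B * g.transpose ∈ primitiveSymm p k := by
  simp only [primitiveSymm, Finset.mem_filter, Finset.mem_univ, true_and,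
    exists_isUnit_iff hk] at hB ⊢
  refine ⟨?_, ?_⟩
  · rw [Matrix.IsSymm, Matrix.transpose_mul, Matrix.transpose_mul, Matrix.transpose_transpose,
      hB.1.eq, Matrix.mul_assoc]
  · rintro ⟨D, hD⟩
    refine hB.2 ⟨h * D * h.transpose, ?_⟩
    have h2 : g.transpose * h.transpose = 1 := by
      rw [← Matrix.transpose_mul, hhg, Matrix.transpose_one]
    calc B = (h * g) * B * (g.transpose * h.transpose) := by rw [hhg, h2, one_mul, mul_one]
      _ = h * (g * B * g.transpose) * h.transpose := by simp only [Matrix.mul_assoc]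
      _ = _ := by rw [hD, Matrix.mul_smul, Matrix.smul_mul]

theorem sum_primitiveSymm_conj {k : ℕ} (hk : k ≠ 0) {g h : Matrix (Fin 2) (Fin 2) (ZMod (p ^ k))}
    (hhg : h * g = 1) (f : Matrix (Fin 2) (Fin 2) (ZMod (p ^ k)) → ℂ) :
    ∑ B ∈ primitiveSymm p k, f (g * B * g.transpose) = ∑ B ∈ primitiveSymm p k, f B := by
  have hgh : g * h = 1 := mul_eq_one_comm.1 hhg
  have h2 : g.transpose * h.transpose = 1 := by
    rw [← Matrix.transpose_mul, hhg, Matrix.transpose_one]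
  have h3 : h.transpose * g.transpose = 1 := mul_eq_one_comm.1 h2
  refine Finset.sum_bij' (fun B _ => g * B * g.transpose) (fun B _ => h * B * h.transpose)
    (fun B hB => conj_mem_primitiveSymm hk hhg hB) (fun B hB => conj_mem_primitiveSymm hk hgh hB)
    (fun B _ => ?_) (fun B _ => ?_) (fun B _ => rfl)
  · calc _ = (h * g) * B * (g.transpose * h.transpose) := by simp only [Matrix.mul_assoc]
      _ = B := by rw [hhg, h2, one_mul, mul_one]
  · calc _ = (g * h) * B * (h.transpose * g.transpose) := by simp only [Matrix.mul_assoc]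
      _ = B := by rw [hgh, h3, one_mul, mul_one]

theorem charMean_eq_charMean_zero_mul {ι : Type} [Fintype ι] (S : Matrix ι ι ℤ_[p])
    (T : Matrix (Fin 2) (Fin 2) ℤ_[p]) (k : ℕ) (B : Matrix (Fin 2) (Fin 2) (ZMod (p ^ k))) :
    charMean S T k B =
      charMean S 0 k B * ZMod.stdAddChar (-(B * T.map (PadicInt.toZModPow k)).trace) := by
  rw [charMean, charMean, mul_assoc, Finset.sum_mul]
  congr 1
  refine Finset.sum_congr rfl fun x _ => ?_
  rw [← AddChar.map_add_eq_mul, Matrix.mul_sub, Matrix.trace_sub, sub_eq_add_neg,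
    Matrix.map_zero _ (map_zero _), sub_zero]

theorem charMean_zero_conj {ι : Type} [Fintype ι] (S : Matrix ι ι ℤ_[p])
    {k : ℕ} {g h : Matrix (Fin 2) (Fin 2) (ZMod (p ^ k))} (hgh : g * h = 1)
    (B : Matrix (Fin 2) (Fin 2) (ZMod (p ^ k))) :
    charMean S 0 k (g * B * g.transpose) = charMean S 0 k B := by
  classical
  rw [charMean_eq_sum, charMean_eq_sum]
  congr 1
  have hhg : h * g = 1 := mul_eq_one_comm.1 hgh
  let e : Matrix ι (Fin 2) (ZMod (p ^ k)) ≃ Matrix ι (Fin 2) (ZMod (p ^ k)) :=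
    { toFun := fun x => x * g
      invFun := fun x => x * h
      left_inv := fun x => by simp [Matrix.mul_assoc, hgh]
      right_inv := fun x => by simp [Matrix.mul_assoc, hhg] }
  refine Fintype.sum_equiv e _ _ fun x => ?_
  congr 1
  rw [Matrix.map_zero _ (map_zero _), sub_zero, sub_zero]
  calc _ = (g * (B * g.transpose * x.transpose * S.map (PadicInt.toZModPow k) * x)).trace := by
        simp only [Matrix.mul_assoc]
    _ = _ := by
        rw [Matrix.trace_mul_comm]
        simp only [e, Equiv.coe_fn_mk, Matrix.transpose_mul, Matrix.mul_assoc]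

/-- The term quadratic in M dies with c², and the two linear terms agree because B and T are
symmetric. -/
theorem trace_conj_one_add {R : Type*} [CommRing R] {c : R} (hc : c * c = 0)
    (M : Matrix (Fin 2) (Fin 2) R) {B T : Matrix (Fin 2) (Fin 2) R} (hB : B.IsSymm)
    (hT : T.IsSymm) :
    ((1 + c • M) * B * (1 + c • M).transpose * T).trace =
      (B * T).trace + (M * ((2 * c) • (B * T))).trace := by
  have hB' : B 1 0 = B 0 1 := hB.apply 0 1
  have hT' : T 1 0 = T 0 1 := hT.apply 0 1
  have h1 : (M * B * (M.transpose * T)).trace * (c * c) = 0 := by rw [hc, mul_zero]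
  have h2 : (B * (M.transpose * T)).trace = (M * (B * T)).trace := by
    rw [← Matrix.trace_transpose, Matrix.transpose_mul, Matrix.transpose_mul,
      Matrix.transpose_transpose, hB.eq, hT.eq, Matrix.trace_mul_comm (M : Matrix _ _ R),
      Matrix.mul_assoc, Matrix.mul_assoc, Matrix.trace_mul_comm T]
    simp only [Matrix.mul_assoc]
    rw [Matrix.trace_mul_comm B]
    simp only [Matrix.mul_assoc]
    rw [Matrix.trace_mul_comm T]
    simp only [Matrix.mul_assoc]
  rw [Matrix.transpose_add, Matrix.transpose_one, Matrix.transpose_smul]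
  simp only [Matrix.add_mul, Matrix.mul_add, Matrix.one_mul, Matrix.mul_one, Matrix.smul_mul,
    Matrix.mul_smul, Matrix.trace_add, Matrix.trace_smul, smul_eq_mul, Matrix.mul_assoc] at h1 h2 ⊢
  rw [h2]
  linear_combination h1

/-- Conjugation by 1 + p^s M permutes the primitive B, preserves Ψ and multiplies the character by
one that is linear in M. Averaging over M leaves only B with p^s BT = 0, and no primitive B
satisfies this. -/
theorem sum_primitiveSymm_mul_stdAddChar_eq_zero (hp2 : p ≠ 2)
    {T : Matrix (Fin 2) (Fin 2) ℤ_[p]} (hT : T.IsSymm) {v k : ℕ} (hv : ¬ (p : ℤ_[p]) ^ v ∣ T.det)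
    (hk : 2 * v < k) (Ψ : Matrix (Fin 2) (Fin 2) (ZMod (p ^ k)) → ℂ)
    (hΨ : ∀ g h B, g * h = 1 → Ψ (g * B * g.transpose) = Ψ B) :
    ∑ B ∈ primitiveSymm p k,
      Ψ B * ZMod.stdAddChar (-(B * T.map (PadicInt.toZModPow k)).trace) = 0 := by
  have hk0 : k ≠ 0 := by omega
  set Tk := T.map (PadicInt.toZModPow k) with hTk
  have hTs : Tk.IsSymm := hT.map _
  obtain ⟨s, rfl⟩ : ∃ s, k = s + v := ⟨k - v, by omega⟩
  -- Here s = k - v > v, so c² = 0, while c · det T ≠ 0 because p^v does not divide det T.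
  set c : ZMod (p ^ (s + v)) := (p : ZMod (p ^ (s + v))) ^ s with hc
  have hcc : c * c = 0 := by
    have : c * c = ((p ^ (s + v) : ℕ) : ZMod (p ^ (s + v))) * p ^ (s - v) := by
      rw [hc]
      push_cast
      rw [← pow_add, ← pow_add]
      congr 1
      omega
    rw [this, ZMod.natCast_self, zero_mul]
  have hinv : ∀ M : Matrix (Fin 2) (Fin 2) (ZMod (p ^ (s + v))),
      (1 - c • M) * (1 + c • M) = 1 ∧ (1 + c • M) * (1 - c • M) = 1 := by
    intro M
    have : (c • M) * (c • M) = 0 := by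
      rw [Matrix.smul_mul, Matrix.mul_smul, smul_smul, hcc, zero_smul]
    constructor
    · rw [sub_mul, mul_add, mul_add, this]
      simp
    · rw [add_mul, mul_sub, mul_sub, this]
      simp
  set F := ∑ B ∈ primitiveSymm p (s + v), Ψ B * ZMod.stdAddChar (-(B * Tk).trace) with hF
  have h1 : ∀ M : Matrix (Fin 2) (Fin 2) (ZMod (p ^ (s + v))),
      F = ∑ B ∈ primitiveSymm p (s + v), Ψ B * ZMod.stdAddChar (-(B * Tk).trace) *
        ZMod.stdAddChar (M * (-((2 * c) • (B * Tk)))).trace := by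
    intro M
    rw [hF, ← sum_primitiveSymm_conj hk0 (hinv M).1]
    refine Finset.sum_congr rfl fun B hB => ?_
    simp only [primitiveSymm, Finset.mem_filter] at hB
    rw [hΨ _ _ _ (hinv M).2, trace_conj_one_add hcc M hB.2.1 hTs, neg_add, AddChar.map_add_eq_mul,
      mul_assoc, Matrix.mul_neg, Matrix.trace_neg]
  have h2 : ∑ _M : Matrix (Fin 2) (Fin 2) (ZMod (p ^ (s + v))), F = 0 := by
    rw [Finset.sum_congr rfl fun M _ => h1 M, Finset.sum_comm]
    refine Finset.sum_eq_zero fun B hB => ?_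
    rw [← Finset.mul_sum, sum_matrix_stdAddChar_trace, mul_zero]
    intro h0
    simp only [primitiveSymm, Finset.mem_filter, Finset.mem_univ, true_and] at hB
    obtain ⟨-, i, j, hij⟩ := hB
    rw [neg_eq_zero, mul_smul, (isUnit_two_zmod hp2 _).smul_eq_zero] at h0
    -- Multiplying by the adjugate of T isolates B, and a unit entry of B then gives c · det T = 0.
    have h3 : (c * Tk.det) • B = 0 := by
      calc _ = (c • (B * Tk)) * Tk.adjugate := by
            rw [Matrix.smul_mul, Matrix.mul_assoc, Matrix.mul_adjugate, Matrix.mul_smul,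
              Matrix.mul_one, smul_smul]
        _ = 0 := by rw [h0, Matrix.zero_mul]
    have h4 := congrFun (congrFun h3 i) j
    rw [Matrix.smul_apply, smul_eq_mul, Matrix.zero_apply, hij.mul_left_eq_zero] at h4
    have h5 : PadicInt.toZModPow (s + v) ((p : ℤ_[p]) ^ s * T.det) = 0 := by
      rw [map_mul, map_pow, map_natCast, RingHom.map_det]
      exact h4
    rw [← RingHom.mem_ker, PadicInt.ker_toZModPow, Ideal.mem_span_singleton, pow_add,
      mul_dvd_mul_iff_left (pow_ne_zero _ (by exact_mod_cast (Fact.out : p.Prime).ne_zero))] at h5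
    exact hv h5
  rw [Finset.sum_const, Finset.card_univ, nsmul_eq_mul] at h2
  refine (mul_eq_zero.1 h2).resolve_left ?_
  exact_mod_cast Fintype.card_ne_zero

theorem exists_not_pow_dvd {z : ℤ_[p]} (hz : z ≠ 0) : ∃ v : ℕ, ¬ (p : ℤ_[p]) ^ v ∣ z := by
  have h : FiniteMultiplicity (p : ℤ_[p]) z :=
    FiniteMultiplicity.of_prime_left PadicInt.prime_p hz
  obtain ⟨n, hn⟩ := h
  exact ⟨n + 1, hn⟩

/-- Each coefficient is a sum of the above kind: the weight `charMean S 0 k`, restricted to a fixed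
`denomExp`, is invariant under conjugation. -/
theorem levelPoly_eq_zero (hp2 : p ≠ 2) {ι : Type} [Fintype ι] (S : Matrix ι ι ℤ_[p])
    {T : Matrix (Fin 2) (Fin 2) ℤ_[p]} (hT : T.IsSymm) {v k : ℕ} (hv : ¬ (p : ℤ_[p]) ^ v ∣ T.det)
    (hk : 2 * v < k) : levelPoly S T k = 0 := by
  ext n
  rw [levelPoly, Polynomial.finsetSum_coeff, Polynomial.coeff_zero,
    ← sum_primitiveSymm_mul_stdAddChar_eq_zero hp2 hT hv hk
      (fun B => if n = denomExp B then charMean S 0 k B else 0)]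
  · refine Finset.sum_congr rfl fun B _ => ?_
    rw [Polynomial.coeff_C_mul_X_pow, charMean_eq_charMean_zero_mul S T]
    split_ifs <;> simp
  · intro g h B hgh
    simp only [denomExp_conj hgh, charMean_zero_conj S hgh]

theorem yangR1Coeff_eq {ι : Type} [Fintype ι] (S : Matrix ι ι ℤ_[p])
    (T : Matrix (Fin 2) (Fin 2) ℤ_[p]) (k : ℕ) [DecidableEq (ZMod (p ^ k))] :
    yangR1Coeff S T k =
      ∑ B ∈ primitiveSymm p k, if B.det = 0 then charMean S T k B else 0 := by
  classical
  rw [← Finset.sum_filter, primitiveSymm, Finset.filter_filter, yangR1Coeff]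
  refine Finset.sum_congr ?_ fun B _ => rfl
  ext B
  simp [and_assoc]

theorem yangR1Coeff_eq_zero (hp2 : p ≠ 2) {ι : Type} [Fintype ι] (S : Matrix ι ι ℤ_[p])
    {T : Matrix (Fin 2) (Fin 2) ℤ_[p]} (hT : T.IsSymm) {v k : ℕ} (hv : ¬ (p : ℤ_[p]) ^ v ∣ T.det)
    (hk : 2 * v < k) : yangR1Coeff S T k = 0 := by
  classical
  rw [yangR1Coeff_eq]
  refine Eq.trans ?_ (sum_primitiveSymm_mul_stdAddChar_eq_zero hp2 hT hv hk
    (fun B => if B.det = 0 then charMean S 0 k B else 0) ?_)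
  · refine Finset.sum_congr rfl fun B _ => ?_
    rw [charMean_eq_charMean_zero_mul S T]
    split_ifs <;> simp
  · intro g h B hgh
    have hu : IsUnit g.det := IsUnit.of_mul_eq_one h.det (by rw [← Matrix.det_mul, hgh, Matrix.det_one])
    simp only [charMean_zero_conj S hgh, Matrix.det_mul, Matrix.det_transpose,
      hu.mul_left_eq_zero, hu.mul_right_eq_zero]

/-- The approximations are constant from t = 2v on, uniformly in r, so small r need no convergence
argument. -/
theorem exists_isRepDensityPolynomial (hp2 : p ≠ 2) {ι : Type} [Fintype ι]
    {S : Matrix ι ι ℤ_[p]} (hS : S.IsSymm) {T : Matrix (Fin 2) (Fin 2) ℤ_[p]} (hT : T.IsSymm)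
    (hdet : T.det ≠ 0) : ∃ F : Polynomial ℂ, IsRepDensityPolynomial S T F := by
  obtain ⟨v, hv⟩ := exists_not_pow_dvd hdet
  refine ⟨∑ k ∈ Finset.range (2 * v + 1), levelPoly S T k, fun r => ?_⟩
  refine tendsto_const_nhds.congr' ?_
  filter_upwards [Filter.eventually_ge_atTop (2 * v)] with t ht
  rw [densityApprox_addHyperbolic hp2 hS hT, Polynomial.eval_finsetSum]
  refine Finset.sum_subset (Finset.range_mono (by omega)) fun k _ hk => ?_
  rw [levelPoly_eq_zero hp2 S hT hv (by simpa using hk), Polynomial.eval_zero]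

theorem exists_polynomial_eq_yangR1 (hp2 : p ≠ 2) {ι : Type} [Fintype ι]
    (S : Matrix ι ι ℤ_[p]) {T : Matrix (Fin 2) (Fin 2) ℤ_[p]} (hT : T.IsSymm)
    (hdet : T.det ≠ 0) : ∃ R : Polynomial ℂ, (R : PowerSeries ℂ) = yangR1 S T := by
  obtain ⟨v, hv⟩ := exists_not_pow_dvd hdet
  refine ⟨PowerSeries.trunc (2 * v + 1) (yangR1 S T), ?_⟩
  ext n
  rw [Polynomial.coeff_coe, PowerSeries.coeff_trunc]
  split_ifs with h
  · rfl
  · rw [yangR1, PowerSeries.coeff_mk, if_neg (by omega),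
      yangR1Coeff_eq_zero hp2 S hT hv (by omega)]

end Vanishing

/-! ### Normal form ⟨-N⟩ ⊥ H of the lattices. -/

section BaseChange

variable {p : ℕ} [Fact p.Prime]

theorem charMean_baseChange {ι ι' : Type} [Fintype ι] [Fintype ι'] [DecidableEq ι]
    [DecidableEq ι'] {S : Matrix ι ι ℤ_[p]} {S' : Matrix ι' ι' ℤ_[p]} {g : Matrix ι' ι ℤ_[p]}
    {h : Matrix ι ι' ℤ_[p]} (hgh : g * h = 1) (hhg : h * g = 1) (hS : S = g.transpose * S' * g)
    (hcard : Fintype.card ι = Fintype.card ι') (T : Matrix (Fin 2) (Fin 2) ℤ_[p]) (k : ℕ)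
    (B : Matrix (Fin 2) (Fin 2) (ZMod (p ^ k))) :
    charMean S T k B = charMean S' T k B := by
  rw [charMean_eq_sum, charMean_eq_sum, hcard]
  congr 1
  have hgh' : g.map (PadicInt.toZModPow k) * h.map (PadicInt.toZModPow k) = 1 := by
    rw [← Matrix.map_mul, hgh, Matrix.map_one _ (map_zero _) (map_one _)]
  have hhg' : h.map (PadicInt.toZModPow k) * g.map (PadicInt.toZModPow k) = 1 := by
    rw [← Matrix.map_mul, hhg, Matrix.map_one _ (map_zero _) (map_one _)]
  let e : Matrix ι (Fin 2) (ZMod (p ^ k)) ≃ Matrix ι' (Fin 2) (ZMod (p ^ k)) :=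
    { toFun := fun x => g.map (PadicInt.toZModPow k) * x
      invFun := fun x => h.map (PadicInt.toZModPow k) * x
      left_inv := fun x => by simp only [← Matrix.mul_assoc, hhg', Matrix.one_mul]
      right_inv := fun x => by simp only [← Matrix.mul_assoc, hgh', Matrix.one_mul] }
  refine Fintype.sum_equiv e _ _ fun x => ?_
  congr 4
  rw [hS, Matrix.map_mul, Matrix.map_mul, Matrix.transpose_map]
  simp only [e, Equiv.coe_fn_mk, Matrix.transpose_mul, Matrix.mul_assoc]

/-- The basis map of the lattice `latticeCalL p N`, in which `N det` is `-N a² + b c`. -/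
noncomputable def calLMap (p : ℕ) [Fact p.Prime] (N : ℕ) :
    (Unit ⊕ (Fin 2 × Fin 1) → ℤ_[p]) →ₗ[ℤ_[p]] Matrix (Fin 2) (Fin 2) ℚ_[p] where
  toFun v := !![(v (Sum.inl ()) : ℚ_[p]), (v (Sum.inr (0, 0)) : ℚ_[p]) / N;
    -(v (Sum.inr (1, 0)) : ℚ_[p]), -(v (Sum.inl ()) : ℚ_[p])]
  map_add' v w := by
    ext i j
    fin_cases i <;> fin_cases j <;> simp <;> ring
  map_smul' s v := by
    ext i j
    fin_cases i <;> fin_cases j <;> simp [Algebra.smul_def] <;> ring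

theorem calLMap_injective {N : ℕ} (hN : N ≠ 0) : Function.Injective (calLMap p N) := by
  intro v w h
  have hN' : (N : ℚ_[p]) ≠ 0 := Nat.cast_ne_zero.2 hN
  have h00 := congrFun (congrFun h 0) 0
  have h01 := congrFun (congrFun h 0) 1
  have h10 := congrFun (congrFun h 1) 0
  simp [calLMap, hN'] at h00 h01 h10
  funext i
  rcases i with i | ⟨i, j⟩
  · exact PadicInt.ext h00
  · fin_cases j
    fin_cases i
    · exact PadicInt.ext h01
    · exact PadicInt.ext h10

theorem range_calLMap (N : ℕ) : LinearMap.range (calLMap p N) = latticeCalL p N := by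
  ext x
  constructor
  · rintro ⟨v, rfl⟩
    exact ⟨v (Sum.inl ()), v (Sum.inr (0, 0)), -v (Sum.inr (1, 0)), by simp [calLMap]⟩
  · rintro ⟨a, b, c, rfl⟩
    refine ⟨Sum.elim (fun _ => a) (fun i => if i.1 = 0 then b else -c), ?_⟩
    simp [calLMap]

theorem latticeL0_eq (p : ℕ) [Fact p.Prime] : latticeL0 p = latticeCalL p 1 := by
  ext x
  constructor
  · rintro ⟨h, hx⟩
    obtain ⟨a, ha⟩ := hx 0 0
    obtain ⟨b, hb⟩ := hx 0 1
    obtain ⟨c, hc⟩ := hx 1 0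
    refine ⟨a, b, c, ?_⟩
    rw [Matrix.trace_fin_two, add_eq_zero_iff_eq_neg'] at h
    ext i j
    fin_cases i <;> fin_cases j <;> simp [ha, hb, hc, h]
  · rintro ⟨a, b, c, rfl⟩
    refine ⟨by simp [Matrix.trace_fin_two], fun i j => ?_⟩
    fin_cases i <;> fin_cases j
    · exact ⟨a, by simp⟩
    · exact ⟨b, by simp⟩
    · exact ⟨c, by simp⟩
    · exact ⟨-a, by simp⟩

/-- Writing the lattice as a unary form plus one plane lets `charMean_addHyperbolic` be applied,
with r = 1, to the lattice itself. -/
theorem exists_baseChange_of_isGramMatrix (hp2 : p ≠ 2) {N : ℕ} (hN : N ≠ 0)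
    {S : Matrix (Fin 3) (Fin 3) ℤ_[p]}
    (hS : IsGramMatrix (fun x => (N : ℚ_[p]) * x.det) (latticeCalL p N) S) :
    ∃ (g : Matrix (Unit ⊕ (Fin 2 × Fin 1)) (Fin 3) ℤ_[p])
      (h : Matrix (Fin 3) (Unit ⊕ (Fin 2 × Fin 1)) ℤ_[p]), g * h = 1 ∧ h * g = 1 ∧
      S = g.transpose * addHyperbolic (Matrix.of fun _ _ : Unit => -(N : ℤ_[p])) 1 * g := by
  obtain ⟨e, he⟩ := hS
  have hN' : (N : ℚ_[p]) ≠ 0 := Nat.cast_ne_zero.2 hN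
  let φ : (Unit ⊕ (Fin 2 × Fin 1) → ℤ_[p]) ≃ₗ[ℤ_[p]] latticeCalL p N :=
    (LinearEquiv.ofInjective _ (calLMap_injective hN)).trans
      (LinearEquiv.ofEq _ _ (range_calLMap N))
  have hφ : ∀ v, (φ v : Matrix (Fin 2) (Fin 2) ℚ_[p]) = calLMap p N v := fun v => rfl
  let b : Module.Basis (Unit ⊕ (Fin 2 × Fin 1)) ℤ_[p] (latticeCalL p N) :=
    Module.Basis.ofEquivFun φ.symm
  refine ⟨b.toMatrix e, e.toMatrix b, b.toMatrix_mul_toMatrix_flip e,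
    e.toMatrix_mul_toMatrix_flip b, ?_⟩
  have h2 : ((Ring.inverse (2 : ℤ_[p]) : ℤ_[p]) : ℚ_[p]) = 1 / 2 := by
    have := congrArg (fun z : ℤ_[p] => (z : ℚ_[p]))
      (Ring.inverse_mul_cancel (2 : ℤ_[p]) (isUnit_two_padicInt hp2))
    simp only [PadicInt.coe_mul, PadicInt.coe_one] at this
    rw [eq_div_iff two_ne_zero]
    exact_mod_cast this
  ext i j
  have hev : ∀ i, (e i : Matrix (Fin 2) (Fin 2) ℚ_[p]) =
      calLMap p N (fun a => b.toMatrix e a i) := by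
    intro i
    rw [← hφ]
    congr 1
    rw [← LinearEquiv.symm_apply_eq]
    funext a
    simp [b, Module.Basis.toMatrix_apply, Module.Basis.ofEquivFun_repr_apply]
  refine PadicInt.ext ?_
  rw [he, hev, hev]
  generalize b.toMatrix e = g
  simp only [Matrix.mul_apply, Matrix.transpose_apply, Fintype.sum_sum_type,
    Fintype.sum_prod_type, Fin.sum_univ_two, Finset.univ_unique, Finset.sum_singleton,
    addHyperbolic, Matrix.fromBlocks_apply₁₁, Matrix.fromBlocks_apply₁₂,
    Matrix.fromBlocks_apply₂₁, Matrix.fromBlocks_apply₂₂, Matrix.blockDiagonal_apply]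
  simp [QuadraticMap.polar, calLMap, Matrix.det_fin_two, h2]
  field_simp
  ring

end BaseChange

/-! ### Gauss integrals at consecutive levels. -/

section LevelRelation

variable {p : ℕ} [Fact p.Prime]

/-- The integral `∫ ψ(ε b[x]) dx` over `x ∈ ℤ_p²`, for `b = p^{-k} B`. -/
noncomputable def gaussMean (k : ℕ) (ε : ZMod (p ^ k))
    (B : Matrix (Fin 2) (Fin 2) (ZMod (p ^ k))) : ℂ :=
  (((p : ℂ) ^ k) ^ 2)⁻¹ * ∑ x : ZMod (p ^ k) × ZMod (p ^ k), ZMod.stdAddChar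
    (ε * (B 0 0 * x.1 ^ 2 + (B 0 1 + B 1 0) * (x.1 * x.2) + B 1 1 * x.2 ^ 2))

theorem charMean_unary (ε : ℤ_[p]) (T : Matrix (Fin 2) (Fin 2) ℤ_[p]) (k : ℕ)
    (B : Matrix (Fin 2) (Fin 2) (ZMod (p ^ k))) :
    charMean (Matrix.of fun _ _ : Unit => ε) T k B =
      gaussMean k (PadicInt.toZModPow k ε) B *
        ZMod.stdAddChar (-(B * T.map (PadicInt.toZModPow k)).trace) := by
  rw [charMean_eq_charMean_zero_mul, charMean_eq_sum, gaussMean]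
  congr 2
  let e : Matrix Unit (Fin 2) (ZMod (p ^ k)) ≃ ZMod (p ^ k) × ZMod (p ^ k) :=
    { toFun := fun x => (x () 0, x () 1)
      invFun := fun x => Matrix.of fun _ => ![x.1, x.2]
      left_inv := fun x => by ext i j; fin_cases j <;> rfl
      right_inv := fun x => rfl }
  refine Fintype.sum_equiv e _ _ fun x => ?_
  congr 1
  change _ = PadicInt.toZModPow k ε * (B 0 0 * x () 0 ^ 2 + (B 0 1 + B 1 0) * (x () 0 * x () 1) +
    B 1 1 * x () 1 ^ 2)
  simp only [Matrix.trace, Matrix.diag, Fin.sum_univ_two, Matrix.mul_apply, Matrix.of_apply,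
    Matrix.transpose_apply, Matrix.map_apply, Matrix.sub_apply, Matrix.zero_apply, map_zero,
    Finset.univ_unique, Finset.sum_singleton, sub_zero, PUnit.default_eq_unit]
  ring

theorem charMean_gram (hp2 : p ≠ 2) {ε : ℤ_[p]} {S : Matrix (Fin 3) (Fin 3) ℤ_[p]}
    {g : Matrix (Unit ⊕ (Fin 2 × Fin 1)) (Fin 3) ℤ_[p]}
    {h : Matrix (Fin 3) (Unit ⊕ (Fin 2 × Fin 1)) ℤ_[p]} (hgh : g * h = 1) (hhg : h * g = 1)
    (hS : S = g.transpose * addHyperbolic (Matrix.of fun _ _ : Unit => ε) 1 * g)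
    (T : Matrix (Fin 2) (Fin 2) ℤ_[p]) {k : ℕ} {B : Matrix (Fin 2) (Fin 2) (ZMod (p ^ k))}
    (hB : B ∈ primitiveSymm p k) :
    charMean S T k B = gaussMean k (PadicInt.toZModPow k ε) B *
        ZMod.stdAddChar (-(B * T.map (PadicInt.toZModPow k)).trace) *
          ((p : ℂ) ^ denomExp B)⁻¹ := by
  rw [charMean_baseChange hgh hhg hS (by simp), charMean_addHyperbolic hp2, pow_one,
    hyperbolicMean_eq hp2 hB, charMean_unary]

/-- For every w, p^w kills the reduction of δ exactly when p^(w+1) kills δ. So the exponent drops by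
one unless δ = 0; this exception produces the R_1 term. -/
theorem max_logOrder_one {k : ℕ} (δ : ZMod (p ^ (k + 1))) :
    max (logOrder δ) 1 = logOrder (reduceHom p k δ) + 1 := by
  have hpr : p.Prime := Fact.out
  have hle : ∀ (n : ℕ) (z : ZMod (p ^ n)) (w : ℕ), logOrder z ≤ w ↔ (p : ZMod (p ^ n)) ^ w * z = 0 := by
    intro n z w
    rw [← Nat.pow_dvd_pow_iff_le_right hpr.one_lt, ← addOrderOf_eq_pow_logOrder,
      addOrderOf_dvd_iff_nsmul_eq_zero, nsmul_eq_mul]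
    push_cast
    rfl
  have key : ∀ w, logOrder (reduceHom p k δ) ≤ w ↔ logOrder δ ≤ w + 1 := by
    intro w
    rw [hle, hle, pow_succ' (p : ZMod (p ^ (k + 1))) w, mul_assoc, prime_mul_eq_zero_iff, map_mul, map_pow, map_natCast]
  have h1 := key (logOrder (reduceHom p k δ))
  have h2 := key (logOrder (reduceHom p k δ) - 1)
  omega

theorem pow_ne_zero_zmod_succ (k : ℕ) : (p : ZMod (p ^ (k + 1))) ^ k ≠ 0 := by
  have hpr : p.Prime := Fact.out
  rw [← Nat.cast_pow, Ne, ZMod.natCast_eq_zero_iff, Nat.pow_dvd_pow_iff_le_right hpr.one_lt]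
  omega

theorem exists_stdAddChar_ne_one {k : ℕ} {z : ZMod (p ^ (k + 1))} (hz : IsUnit z) :
    ∃ s : ZMod (p ^ (k + 1)), ZMod.stdAddChar (((p : ZMod (p ^ (k + 1))) ^ k * s) * z) ≠ (1 : ℂ) := by
  by_contra! h
  obtain ⟨u, rfl⟩ := hz
  have h1 := h (u⁻¹ : (ZMod (p ^ (k + 1)))ˣ)
  rw [mul_assoc, Units.inv_mul, mul_one, ← AddChar.map_zero_eq_one (ZMod.stdAddChar (N := p ^ (k + 1)))] at h1
  exact pow_ne_zero_zmod_succ k (ZMod.injective_stdAddChar h1)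

/-- Shifting a (if x is a unit) or d (if y is) by a suitable p^k s fixes the reduction and
multiplies the sum by a character value other than 1. -/
theorem sum_isSymm_comp_reduceHom_eq_zero (k : ℕ) {x y ε : ZMod (p ^ (k + 1))} (hε : IsUnit ε)
    (hxy : IsUnit x ∨ IsUnit y) (Φ : Matrix (Fin 2) (Fin 2) (ZMod (p ^ k)) → ℂ) :
    ∑ a, ∑ b, ∑ d, Φ ((!![a, b; b, d] : Matrix _ _ (ZMod (p ^ (k + 1)))).map (reduceHom p k)) *
      ZMod.stdAddChar (ε * (a * x ^ 2 + (b + b) * (x * y) + d * y ^ 2)) = 0 := by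
  have hpk : ∀ s : ZMod (p ^ (k + 1)), reduceHom p k ((p : ZMod (p ^ (k + 1))) ^ k * s) = 0 := by
    intro s
    rw [map_mul, map_pow, map_natCast, ← Nat.cast_pow, ZMod.natCast_self, zero_mul]
  have hmap : ∀ a b c d : ZMod (p ^ (k + 1)), (!![a, b; c, d]).map (reduceHom p k) =
      !![reduceHom p k a, reduceHom p k b; reduceHom p k c, reduceHom p k d] := by
    intro a b c d
    ext i j
    fin_cases i <;> fin_cases j <;> rfl
  rcases hxy with hu | hu
  · obtain ⟨s, hs⟩ := exists_stdAddChar_ne_one (hε.mul (hu.pow 2))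
    refine (mul_eq_zero.1 ?_).resolve_left (sub_ne_zero.2 hs)
    rw [sub_mul, one_mul, sub_eq_zero, Finset.mul_sum]
    refine Fintype.sum_equiv (Equiv.addRight ((p : ZMod (p ^ (k + 1))) ^ k * s)) _ _ fun a => ?_
    rw [Finset.mul_sum]
    refine Finset.sum_congr rfl fun b _ => ?_
    rw [Finset.mul_sum]
    refine Finset.sum_congr rfl fun d _ => ?_
    rw [mul_left_comm, ← AddChar.map_add_eq_mul]
    simp only [hmap, Equiv.coe_addRight, map_add, hpk, add_zero]
    congr 2
    ring
  · obtain ⟨s, hs⟩ := exists_stdAddChar_ne_one (hε.mul (hu.pow 2))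
    refine (mul_eq_zero.1 ?_).resolve_left (sub_ne_zero.2 hs)
    rw [sub_mul, one_mul, sub_eq_zero, Finset.mul_sum]
    refine Finset.sum_congr rfl fun a _ => ?_
    rw [Finset.mul_sum]
    refine Finset.sum_congr rfl fun b _ => ?_
    rw [Finset.mul_sum]
    refine Fintype.sum_equiv (Equiv.addRight ((p : ZMod (p ^ (k + 1))) ^ k * s)) _ _ fun d => ?_
    rw [mul_left_comm, ← AddChar.map_add_eq_mul]
    simp only [hmap, Equiv.coe_addRight, map_add, hpk, add_zero]
    congr 2
    ring

theorem sum_rotate_four {α β : Type*} [Fintype α] [Fintype β] (f : α → α → α → β → ℂ) :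
    ∑ a, ∑ b, ∑ d, ∑ x, f a b d x = ∑ x, ∑ a, ∑ b, ∑ d, f a b d x := by
  symm
  rw [Finset.sum_comm]
  refine Finset.sum_congr rfl fun a _ => ?_
  rw [Finset.sum_comm]
  refine Finset.sum_congr rfl fun b _ => ?_
  rw [Finset.sum_comm]

theorem sum_reduceHom_triple (k : ℕ) (F : ZMod (p ^ k) → ZMod (p ^ k) → ZMod (p ^ k) → ℂ) :
    ∑ a, ∑ b, ∑ d, F (reduceHom p k a) (reduceHom p k b) (reduceHom p k d) =
      (p : ℂ) ^ 3 * ∑ a, ∑ b, ∑ d, F a b d := by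
  have hp : (p : ℂ) ≠ 0 := Nat.cast_ne_zero.2 (Fact.out : p.Prime).ne_zero
  have h1 : ∀ f : ZMod (p ^ k) → ℂ, ∑ a, f (reduceHom p k a) = p * ∑ a, f a := by
    intro f
    have := card_mul_sum_comp_surjective (reduceHom p k).toAddMonoidHom
      (reduceHom_surjective p k) f
    rw [ZMod.card, ZMod.card] at this
    push_cast at this
    refine mul_left_cancel₀ (pow_ne_zero k hp) ?_
    rw [← mul_assoc, ← pow_succ]
    exact this
  rw [h1 (fun a => ∑ b, ∑ d, F a (reduceHom p k b) (reduceHom p k d)),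
    Finset.sum_congr rfl fun a _ => h1 (fun b => ∑ d, F a b (reduceHom p k d)),
    Finset.sum_congr rfl fun a _ => congrArg _ (Finset.sum_congr rfl fun b _ => h1 (F a b))]
  simp only [← Finset.mul_sum]
  ring

-- By the preceding vanishing only x = px' survive, and p² · p^{-(k+1)} ε = p^{-k} · pε. The factor
-- p is p³, the number of symmetric lifts, divided by p² from the normalisations.
open Classical in
theorem sum_isSymm_comp_reduceHom_mul_gaussMean (k : ℕ) {ε : ZMod (p ^ (k + 1))} (hε : IsUnit ε)
    (Φ : Matrix (Fin 2) (Fin 2) (ZMod (p ^ k)) → ℂ) :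
    ∑ C : Matrix (Fin 2) (Fin 2) (ZMod (p ^ (k + 1))) with C.IsSymm,
        Φ (C.map (reduceHom p k)) * gaussMean (k + 1) ε C =
      p * ∑ B : Matrix (Fin 2) (Fin 2) (ZMod (p ^ k)) with B.IsSymm,
        Φ B * gaussMean k ((p : ZMod (p ^ k)) * reduceHom p k ε) B := by
  have hp : (p : ℂ) ≠ 0 := Nat.cast_ne_zero.2 (Fact.out : p.Prime).ne_zero
  rw [sum_isSymm_eq, sum_isSymm_eq]
  set G : ZMod (p ^ (k + 1)) × ZMod (p ^ (k + 1)) → ℂ := fun x =>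
    ∑ a, ∑ b, ∑ d, Φ ((!![a, b; b, d] : Matrix _ _ (ZMod (p ^ (k + 1)))).map (reduceHom p k)) *
      ZMod.stdAddChar (ε * (a * x.1 ^ 2 + (b + b) * (x.1 * x.2) + d * x.2 ^ 2)) with hG
  set G' : ZMod (p ^ k) × ZMod (p ^ k) → ℂ := fun x =>
    ∑ a, ∑ b, ∑ d, Φ !![a, b; b, d] * ZMod.stdAddChar (((p : ZMod (p ^ k)) * reduceHom p k ε) *
      (a * x.1 ^ 2 + (b + b) * (x.1 * x.2) + d * x.2 ^ 2)) with hG'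
  have hL : ∑ a, ∑ b, ∑ d,
      Φ ((!![a, b; b, d] : Matrix _ _ (ZMod (p ^ (k + 1)))).map (reduceHom p k)) *
        gaussMean (k + 1) ε !![a, b; b, d] = (((p : ℂ) ^ (k + 1)) ^ 2)⁻¹ * ∑ x, G x := by
    simp only [hG, gaussMean]
    simp only [Finset.mul_sum]
    rw [← sum_rotate_four]
    refine Finset.sum_congr rfl fun a _ => Finset.sum_congr rfl fun b _ =>
      Finset.sum_congr rfl fun d _ => Finset.sum_congr rfl fun x _ => mul_left_comm _ _ _
  have hR : ∑ a, ∑ b, ∑ d, Φ !![a, b; b, d] *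
        gaussMean k ((p : ZMod (p ^ k)) * reduceHom p k ε) !![a, b; b, d] =
      (((p : ℂ) ^ k) ^ 2)⁻¹ * ∑ x, G' x := by
    simp only [hG', gaussMean]
    simp only [Finset.mul_sum]
    rw [← sum_rotate_four]
    refine Finset.sum_congr rfl fun a _ => Finset.sum_congr rfl fun b _ =>
      Finset.sum_congr rfl fun d _ => Finset.sum_congr rfl fun x _ => mul_left_comm _ _ _
  have hmain : ∑ x, G x = (p : ℂ) ^ 3 * ∑ x, G' x := by
    set s := Function.surjInv (reduceHom_surjective p k)
    have hs : ∀ z, reduceHom p k (s z) = z := Function.surjInv_eq (reduceHom_surjective p k)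
    rw [Finset.mul_sum]
    symm
    refine Fintype.sum_of_injective
      (fun x : ZMod (p ^ k) × ZMod (p ^ k) =>
        ((p : ZMod (p ^ (k + 1))) * s x.1, (p : ZMod (p ^ (k + 1))) * s x.2)) ?_ _ _ ?_ ?_
    · rintro ⟨x, y⟩ ⟨x', y'⟩ h
      simp only [Prod.mk.injEq, prime_mul_eq_prime_mul_iff, hs] at h
      exact Prod.ext h.1 h.2
    · rintro ⟨x, y⟩ hx
      refine sum_isSymm_comp_reduceHom_eq_zero k hε ?_ Φ
      by_contra! hcon
      simp only [isUnit_zmod_iff _ k.succ_ne_zero, not_not] at hcon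
      obtain ⟨⟨z, rfl⟩, ⟨w, rfl⟩⟩ := hcon
      refine hx ⟨(reduceHom p k z, reduceHom p k w), ?_⟩
      simp only [Prod.mk.injEq, prime_mul_eq_prime_mul_iff, hs, and_self]
    · rintro ⟨z, w⟩
      rw [← sum_reduceHom_triple]
      refine Finset.sum_congr rfl fun a _ => Finset.sum_congr rfl fun b _ =>
        Finset.sum_congr rfl fun d _ => ?_
      congr 1
      · congr 1
        ext i j
        fin_cases i <;> fin_cases j <;> rfl
      · have : ε * (a * (p * s z) ^ 2 + (b + b) * ((p * s z) * (p * s w)) + d * (p * s w) ^ 2) =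
            p * ((p * ε) * (a * s z ^ 2 + (b + b) * (s z * s w) + d * s w ^ 2)) := by ring
        simp only [this, stdAddChar_prime_mul, map_mul, map_add, map_pow, hs, map_natCast]
  rw [hL, hR, hmain]
  field_simp
  ring

end LevelRelation

/-! ### Comparing level k of 𝓛 with level k+1 of L₀. -/

section GramRelation

variable {p : ℕ} [Fact p.Prime]

open Classical in
theorem sum_isSymm_ite_primitive (k : ℕ) (f : Matrix (Fin 2) (Fin 2) (ZMod (p ^ k)) → ℂ) :
    (∑ B : Matrix (Fin 2) (Fin 2) (ZMod (p ^ k)) with B.IsSymm,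
      if B ∈ primitiveSymm p k then f B else 0) = ∑ B ∈ primitiveSymm p k, f B := by
  rw [Finset.sum_ite_mem, Finset.inter_eq_right.2]
  intro B hB
  simp only [primitiveSymm, Finset.mem_filter, Finset.mem_univ, true_and] at hB ⊢
  exact hB.1

theorem map_reduceHom_mem_primitiveSymm {k : ℕ} (hk : k ≠ 0)
    {C : Matrix (Fin 2) (Fin 2) (ZMod (p ^ (k + 1)))} (hC : C.IsSymm) :
    C.map (reduceHom p k) ∈ primitiveSymm p k ↔ C ∈ primitiveSymm p (k + 1) := by
  simp only [primitiveSymm, Finset.mem_filter, Finset.mem_univ, true_and, Matrix.map_apply,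
    isUnit_reduceHom_iff k hk, hC, hC.map]

theorem smul_mem_primitiveSymm {k : ℕ} {u : ZMod (p ^ k)} (hu : IsUnit u)
    {B : Matrix (Fin 2) (Fin 2) (ZMod (p ^ k))} (hB : B ∈ primitiveSymm p k) :
    u • B ∈ primitiveSymm p k := by
  simp only [primitiveSymm, Finset.mem_filter, Finset.mem_univ, true_and] at hB ⊢
  obtain ⟨hs, i, j, hij⟩ := hB
  exact ⟨hs.smul u, i, j, hu.mul hij⟩

theorem sum_primitiveSymm_smul {k : ℕ} (u : (ZMod (p ^ k))ˣ)
    (f : Matrix (Fin 2) (Fin 2) (ZMod (p ^ k)) → ℂ) :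
    ∑ B ∈ primitiveSymm p k, f ((u : ZMod (p ^ k)) • B) = ∑ B ∈ primitiveSymm p k, f B := by
  refine Finset.sum_bij' (fun B _ => (u : ZMod (p ^ k)) • B)
    (fun B _ => ((u⁻¹ : (ZMod (p ^ k))ˣ) : ZMod (p ^ k)) • B)
    (fun B hB => smul_mem_primitiveSymm u.isUnit hB)
    (fun B hB => smul_mem_primitiveSymm (u⁻¹).isUnit hB)
    (fun B _ => by rw [smul_smul, Units.inv_mul, one_smul])
    (fun B _ => by rw [smul_smul, Units.mul_inv, one_smul]) (fun B _ => rfl)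

/-- Substitute x ↦ ux, as (εu)(uB)[x] = ε B[ux]. -/
theorem gaussMean_mul_unit_smul {k : ℕ} (u : (ZMod (p ^ k))ˣ) (ε : ZMod (p ^ k))
    (B : Matrix (Fin 2) (Fin 2) (ZMod (p ^ k))) :
    gaussMean k (ε * (u : ZMod (p ^ k))) ((u : ZMod (p ^ k)) • B) = gaussMean k ε B := by
  rw [gaussMean, gaussMean]
  congr 1
  let e : ZMod (p ^ k) × ZMod (p ^ k) ≃ ZMod (p ^ k) × ZMod (p ^ k) :=
    Equiv.prodCongr u.mulLeft u.mulLeft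
  refine Fintype.sum_equiv e _ _ fun x => ?_
  congr 1
  have h1 : (e x).1 = u * x.1 := rfl
  have h2 : (e x).2 = u * x.2 := rfl
  simp only [h1, h2, Matrix.smul_apply, smul_eq_mul]
  ring

theorem denomExp_unit_smul {p k : ℕ} (u : (ZMod (p ^ k))ˣ)
    (B : Matrix (Fin 2) (Fin 2) (ZMod (p ^ k))) :
    denomExp ((u : ZMod (p ^ k)) • B) = denomExp B := by
  rw [denomExp, denomExp, Matrix.det_smul, Fintype.card_fin,
    logOrder_mul_of_isUnit (u.isUnit.pow 2)]

/-- For primitive `B`, the local integral of a form `ε x² ⊥ H`. -/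
def HasUnaryMean (ε : ℤ_[p]) (S : Matrix (Fin 3) (Fin 3) ℤ_[p]) : Prop :=
  ∀ (T : Matrix (Fin 2) (Fin 2) ℤ_[p]) (k : ℕ), ∀ B ∈ primitiveSymm p k,
    charMean S T k B = gaussMean k (PadicInt.toZModPow k ε) B *
      ZMod.stdAddChar (-(B * T.map (PadicInt.toZModPow k)).trace) * ((p : ℂ) ^ denomExp B)⁻¹

theorem levelPoly_eval_of_hasUnaryMean {ε : ℤ_[p]} {S : Matrix (Fin 3) (Fin 3) ℤ_[p]}
    (hS : HasUnaryMean ε S) (T : Matrix (Fin 2) (Fin 2) ℤ_[p]) (k : ℕ) (y : ℂ) :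
    (levelPoly S T k).eval (p * y) = ∑ B ∈ primitiveSymm p k,
      gaussMean k (PadicInt.toZModPow k ε) B *
        ZMod.stdAddChar (-(B * T.map (PadicInt.toZModPow k)).trace) * y ^ denomExp B := by
  have hp : (p : ℂ) ≠ 0 := Nat.cast_ne_zero.2 (Fact.out : p.Prime).ne_zero
  rw [levelPoly_eval]
  refine Finset.sum_congr rfl fun B hB => ?_
  rw [hS T k B hB, mul_pow, mul_assoc, inv_mul_cancel_left₀ (pow_ne_zero _ hp)]

theorem yangR1Coeff_of_hasUnaryMean {ε : ℤ_[p]} {S : Matrix (Fin 3) (Fin 3) ℤ_[p]}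
    (hS : HasUnaryMean ε S) (T : Matrix (Fin 2) (Fin 2) ℤ_[p]) (k : ℕ) :
    (p : ℂ) ^ k * yangR1Coeff S T k = ∑ B ∈ primitiveSymm p k, if B.det = 0 then
      gaussMean k (PadicInt.toZModPow k ε) B *
        ZMod.stdAddChar (-(B * T.map (PadicInt.toZModPow k)).trace) else 0 := by
  have hp : (p : ℂ) ≠ 0 := Nat.cast_ne_zero.2 (Fact.out : p.Prime).ne_zero
  rw [yangR1Coeff_eq, Finset.mul_sum]
  refine Finset.sum_congr rfl fun B hB => ?_
  split_ifs with h
  · rw [hS T k B hB, denomExp, h, (logOrder_eq_zero_iff _).2 rfl, add_zero, mul_comm, mul_assoc,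
      inv_mul_cancel₀ (pow_ne_zero _ hp), mul_one]
  · rw [mul_zero]

/-- The argument py cancels the p^(-`denomExp`) of the plane inside each lattice. The case k = 0 is
excluded because over the trivial ring every reduction is primitive, even that of C = 0. -/
theorem levelPoly_eval_relation {u : ℕ} (hu : u.Coprime p)
    {S S₀ : Matrix (Fin 3) (Fin 3) ℤ_[p]} (hS : HasUnaryMean (-((p * u : ℕ) : ℤ_[p])) S)
    (hS₀ : HasUnaryMean (-1) S₀) (T : Matrix (Fin 2) (Fin 2) ℤ_[p]) {k : ℕ} (hk : k ≠ 0) (y : ℂ) :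
    (p * y) ^ 2 * (levelPoly S T k).eval (p * y) =
      p * (levelPoly S₀ (((p * u : ℕ) : ℤ_[p]) • T) (k + 1)).eval (p * y) +
      (p * y - p) * (yangR1Coeff S₀ (((p * u : ℕ) : ℤ_[p]) • T) (k + 1) * (p * y) ^ (k + 1)) := by
  classical
  set T' := ((p * u : ℕ) : ℤ_[p]) • T with hT'
  have hunit : IsUnit (u : ZMod (p ^ k)) :=
    (ZMod.isUnit_iff_coprime _ _).2 (Nat.Coprime.pow_right k hu)
  obtain ⟨v, hv⟩ := hunit
  -- The exponent is raised by 1 so that, by `max_logOrder_one`, it becomes the maximum of `logOrder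
  -- C.det` and 1 on lifts C.
  set Φ : Matrix (Fin 2) (Fin 2) (ZMod (p ^ k)) → ℂ := fun B =>
    if B ∈ primitiveSymm p k then ZMod.stdAddChar
      (-(((u : ZMod (p ^ k)) • B) * T.map (PadicInt.toZModPow k)).trace) *
        y ^ (logOrder B.det + 1) else 0 with hΦ
  have hL : (levelPoly S T k).eval (p * y) * y = y ^ k *
      ∑ B : Matrix (Fin 2) (Fin 2) (ZMod (p ^ k)) with B.IsSymm,
        Φ B * gaussMean k ((p : ZMod (p ^ k)) * reduceHom p k (-1)) B := by
    rw [levelPoly_eval_of_hasUnaryMean hS, ← sum_primitiveSymm_smul v]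
    simp only [hΦ, ite_mul, zero_mul]
    rw [sum_isSymm_ite_primitive, Finset.sum_mul, Finset.mul_sum]
    refine Finset.sum_congr rfl fun B _ => ?_
    have h1 : PadicInt.toZModPow k (-((p * u : ℕ) : ℤ_[p])) = p * reduceHom p k (-1) * v := by
      rw [hv, map_neg, map_natCast, map_neg, map_one]
      push_cast
      ring
    rw [h1, gaussMean_mul_unit_smul, denomExp_unit_smul, hv, denomExp]
    ring
  have hR : ∑ C : Matrix (Fin 2) (Fin 2) (ZMod (p ^ (k + 1))) with C.IsSymm,
      Φ (C.map (reduceHom p k)) * gaussMean (k + 1) (-1) C =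
      ∑ C ∈ primitiveSymm p (k + 1), gaussMean (k + 1) (-1) C *
        ZMod.stdAddChar (-(C * T'.map (PadicInt.toZModPow (k + 1))).trace) *
          y ^ max (logOrder C.det) 1 := by
    rw [← sum_isSymm_ite_primitive]
    refine Finset.sum_congr rfl fun C hC => ?_
    have hC' : C.IsSymm := (Finset.mem_filter.1 hC).2
    simp only [hΦ, map_reduceHom_mem_primitiveSymm hk hC', ite_mul, zero_mul]
    refine if_congr Iff.rfl ?_ rfl
    have h1 : (C.map (reduceHom p k)).det = reduceHom p k C.det :=
      (RingHom.map_det (reduceHom p k) C).symm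
    have h2 : -(C * T'.map (PadicInt.toZModPow (k + 1))).trace = (p : ZMod (p ^ (k + 1))) *
        -(((u : ZMod (p ^ (k + 1))) • C) * T.map (PadicInt.toZModPow (k + 1))).trace := by
      have : T'.map (PadicInt.toZModPow (k + 1)) =
          ((p : ZMod (p ^ (k + 1))) * u) • T.map (PadicInt.toZModPow (k + 1)) := by
        ext i j
        simp [hT']
      rw [this, Matrix.mul_smul, Matrix.trace_smul, Matrix.smul_mul, Matrix.trace_smul,
        smul_eq_mul, smul_eq_mul]
      ring
    have h3 : reduceHom p k
        (-(((u : ZMod (p ^ (k + 1))) • C) * T.map (PadicInt.toZModPow (k + 1))).trace) =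
        -(((u : ZMod (p ^ k)) • C.map (reduceHom p k)) * T.map (PadicInt.toZModPow k)).trace := by
      have e2 : (T.map (PadicInt.toZModPow (k + 1))).map (reduceHom p k) =
          T.map (PadicInt.toZModPow k) := by
        ext i j; simp
      rw [map_neg, Matrix.smul_mul, Matrix.trace_smul, Matrix.smul_mul, Matrix.trace_smul,
        smul_eq_mul, smul_eq_mul, map_mul, map_natCast, AddMonoidHom.map_trace (reduceHom p k),
        Matrix.map_mul, e2]
    rw [h1, max_logOrder_one, h2, stdAddChar_prime_mul, h3]
    ring
  have hrel := sum_isSymm_comp_reduceHom_mul_gaussMean k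
    (isUnit_one.neg : IsUnit (-1 : ZMod (p ^ (k + 1)))) Φ
  rw [hR] at hrel
  have hG := levelPoly_eval_of_hasUnaryMean hS₀ T' (k + 1) y
  have hc := yangR1Coeff_of_hasUnaryMean hS₀ T' (k + 1)
  rw [map_neg, map_one] at hG hc
  -- The maximum differs from `logOrder C.det` only when det C = 0, where y stands in place of 1;
  -- hence the factor y - 1.
  have hsum : y * y ^ k * ∑ C ∈ primitiveSymm p (k + 1), gaussMean (k + 1) (-1) C *
        ZMod.stdAddChar (-(C * T'.map (PadicInt.toZModPow (k + 1))).trace) *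
          y ^ max (logOrder C.det) 1 =
      (levelPoly S₀ T' (k + 1)).eval (p * y) +
        (y - 1) * y ^ (k + 1) * ((p : ℂ) ^ (k + 1) * yangR1Coeff S₀ T' (k + 1)) := by
    rw [hG, hc, Finset.mul_sum, Finset.mul_sum, ← Finset.sum_add_distrib]
    refine Finset.sum_congr rfl fun C _ => ?_
    split_ifs with h
    · rw [denomExp, h, (logOrder_eq_zero_iff _).2 rfl]
      simp only [zero_le, sup_of_le_right, add_zero]
      ring
    · have h1 : 1 ≤ logOrder C.det :=
        Nat.one_le_iff_ne_zero.2 fun h0 => h ((logOrder_eq_zero_iff _).1 h0)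
      rw [max_eq_left h1, denomExp]
      ring
  rw [mul_pow (p : ℂ) y (k + 1)]
  rw [hrel] at hsum
  linear_combination (p : ℂ) * hsum + (p : ℂ) ^ 2 * y * hL

theorem subsingleton_zmod_pow_zero (p : ℕ) : Subsingleton (ZMod (p ^ 0)) := by
  rw [pow_zero]
  infer_instance

theorem levelPoly_zero {ι : Type} [Fintype ι] (S : Matrix ι ι ℤ_[p])
    (T : Matrix (Fin 2) (Fin 2) ℤ_[p]) : levelPoly S T 0 = 1 := by
  classical
  have := subsingleton_zmod_pow_zero p
  have h1 : primitiveSymm p 0 = {0} := by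
    ext B
    simp only [primitiveSymm, Finset.mem_filter, Finset.mem_univ, true_and, Finset.mem_singleton]
    exact ⟨fun _ => Subsingleton.elim _ _, fun _ =>
      ⟨Subsingleton.elim _ _, 0, 0, isUnit_of_subsingleton _⟩⟩
  have h2 : charMean S T 0 0 = 1 := by
    rw [charMean_eq_sum, Fintype.sum_subsingleton _ 0, Subsingleton.elim (Matrix.trace _) 0,
      AddChar.map_zero_eq_one]
    simp
  rw [levelPoly, h1, Finset.sum_singleton, h2, denomExp, Subsingleton.elim (Matrix.det _) 0,
    (logOrder_eq_zero_iff _).2 rfl]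
  simp

theorem gaussMean_zero_right (k : ℕ) (ε : ZMod (p ^ k)) : gaussMean k ε 0 = 1 := by
  have hp : (p : ℂ) ≠ 0 := Nat.cast_ne_zero.2 (Fact.out : p.Prime).ne_zero
  simp [gaussMean, ZMod.card]
  field_simp

-- This is the level relation for k = 0 and Φ = 1, with a single class below.
open Classical in
theorem sum_isSymm_gaussMean_one {ε : ZMod (p ^ (0 + 1))} (hε : IsUnit ε) :
    ∑ C : Matrix (Fin 2) (Fin 2) (ZMod (p ^ (0 + 1))) with C.IsSymm, gaussMean (0 + 1) ε C = p := by
  have := subsingleton_zmod_pow_zero p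
  have h := sum_isSymm_comp_reduceHom_mul_gaussMean 0 hε (fun _ => 1)
  simp only [one_mul] at h
  rw [h, sum_isSymm_eq, Fintype.sum_subsingleton _ 0, Fintype.sum_subsingleton _ 0,
    Fintype.sum_subsingleton _ 0, Subsingleton.elim !![_, _; _, _] 0, gaussMean_zero_right, mul_one]

theorem isUnit_or_eq_zero_zmod_pow_one (z : ZMod (p ^ (0 + 1))) : IsUnit z ∨ z = 0 := by
  rw [or_iff_not_imp_left, isUnit_zmod_iff _ one_ne_zero, not_not]
  rintro ⟨w, rfl⟩
  have : (p : ZMod (p ^ (0 + 1))) = 0 := by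
    have := ZMod.natCast_self (p ^ (0 + 1))
    simpa using this
  rw [this, zero_mul]

-- Split by the corner entry a. For a ≠ 0 the singular C contribute the one-variable Gauss sum G(a);
-- since G(0) = p and all G(a) add up to p, these cancel. The matrices with a = 0 contribute 1.
open Classical in
theorem sum_isSymm_det_eq_zero_gaussMean_one {ε : ZMod (p ^ (0 + 1))} (hε : IsUnit ε) :
    (∑ C : Matrix (Fin 2) (Fin 2) (ZMod (p ^ (0 + 1))) with C.IsSymm,
      if C.det = 0 then gaussMean (0 + 1) ε C else 0) = 1 := by
  have hp : (p : ℂ) ≠ 0 := Nat.cast_ne_zero.2 (Fact.out : p.Prime).ne_zero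
  rw [sum_isSymm_eq]
  set W : ZMod (p ^ (0 + 1)) → ℂ := fun a => ∑ b, ∑ d,
    if (!![a, b; b, d]).det = 0 then gaussMean (0 + 1) ε !![a, b; b, d] else 0 with hW
  set G : ZMod (p ^ (0 + 1)) → ℂ := fun a => ∑ x, ZMod.stdAddChar (a * (ε * x ^ 2)) with hG
  have hcard : ((p ^ (0 + 1) : ℕ) : ℂ) = p := by simp
  have hsq : ∀ x : ZMod (p ^ (0 + 1)), ε * x ^ 2 = 0 ↔ x = 0 := by
    intro x
    rw [hε.mul_right_eq_zero]
    constructor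
    · intro h
      rcases isUnit_or_eq_zero_zmod_pow_one x with hx | hx
      · have h0 := hx.pow 2
        rw [h, isUnit_zero_iff] at h0
        rw [← mul_one x, ← h0, mul_zero]
      · exact hx
    · rintro rfl
      simp
  have hGsum : ∑ a, G a = p := by
    simp only [hG]
    rw [Finset.sum_comm]
    simp only [sum_addChar_mul, hsq]
    simp
  have hG0 : G 0 = p := by
    simp [hG]
  -- Singularity forces d = b²/a, and completing the square makes each of the p values of b
  -- contribute G(a)/p.
  have hWG : ∀ a, IsUnit a → W a = G a := by
    intro a ha
    obtain ⟨c, hac⟩ := ha.exists_right_inv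
    have h1 : ∀ b, (∑ d, if (!![a, b; b, d]).det = 0 then
        gaussMean (0 + 1) ε !![a, b; b, d] else 0) = (p : ℂ)⁻¹ * G a := by
      intro b
      rw [Finset.sum_eq_single (c * b ^ 2)]
      · rw [if_pos, gaussMean, Fintype.sum_prod_type, Finset.sum_comm]
        · have h2 : ∀ y : ZMod (p ^ (0 + 1)), ∑ x : ZMod (p ^ (0 + 1)), ZMod.stdAddChar
              (ε * (a * x ^ 2 + (b + b) * (x * y) +
                (c * b ^ 2) * y ^ 2)) = G a := by
            intro y
            refine Fintype.sum_equiv (Equiv.addRight (c * b * y))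
              _ _ fun x => ?_
            congr 1
            simp only [Equiv.coe_addRight]
            linear_combination (-ε * (2 * b * x * y +
              c * b ^ 2 * y ^ 2)) * hac
          simp only [Matrix.of_apply, Matrix.cons_val_zero, Matrix.cons_val_one, Matrix.cons_val',
            Matrix.cons_val_fin_one, h2, Finset.sum_const, Finset.card_univ, ZMod.card,
            nsmul_eq_mul, hcard]
          field_simp
          simp
        · rw [Matrix.det_fin_two_of]
          linear_combination b ^ 2 * hac
      · intro d _ hd
        rw [if_neg]
        intro h
        rw [Matrix.det_fin_two_of] at h
        refine hd ?_
        linear_combination c * h - d * hac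
      · simp
    simp only [hW, h1, Finset.sum_const, Finset.card_univ, ZMod.card, nsmul_eq_mul, hcard]
    field_simp
  have hW0 : W 0 = 1 := by
    have hb : ∀ b d : ZMod (p ^ (0 + 1)), (!![0, b; b, d]).det = 0 ↔ b = 0 := by
      intro b d
      rw [Matrix.det_fin_two_of, zero_mul, zero_sub, neg_eq_zero]
      constructor
      · intro h
        rcases isUnit_or_eq_zero_zmod_pow_one b with hx | hx
        · rwa [hx.mul_right_eq_zero] at h
        · exact hx
      · rintro rfl
        simp
    simp only [hW, hb]
    rw [Finset.sum_eq_single 0 (fun b _ hb => by simp [hb]) (by simp)]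
    simp only [if_true, gaussMean, ← Finset.mul_sum]
    rw [Finset.sum_comm]
    have h3 : ∀ x : ZMod (p ^ (0 + 1)) × ZMod (p ^ (0 + 1)), ∑ d : ZMod (p ^ (0 + 1)),
        ZMod.stdAddChar (ε * ((!![0, 0; 0, d] : Matrix (Fin 2) (Fin 2) (ZMod (p ^ (0 + 1)))) 0 0
          * x.1 ^ 2 + ((!![0, 0; 0, d] : Matrix (Fin 2) (Fin 2) (ZMod (p ^ (0 + 1)))) 0 1 +
          (!![0, 0; 0, d] : Matrix (Fin 2) (Fin 2) (ZMod (p ^ (0 + 1)))) 1 0) * (x.1 * x.2) +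
          (!![0, 0; 0, d] : Matrix (Fin 2) (Fin 2) (ZMod (p ^ (0 + 1)))) 1 1 * x.2 ^ 2)) =
        if x.2 = 0 then (p : ℂ) else 0 := by
      intro x
      rw [← hcard, ← if_congr (hsq x.2) rfl rfl, ← sum_addChar_mul]
      refine Finset.sum_congr rfl fun d _ => ?_
      congr 1
      simp
      ring
    simp only [h3]
    rw [Fintype.sum_prod_type]
    simp
    field_simp
  have hsplit : ∑ a, W a - W 0 = ∑ a, G a - G 0 := by
    rw [← Finset.sum_erase_eq_sub (Finset.mem_univ 0), ← Finset.sum_erase_eq_sub (Finset.mem_univ 0)]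
    refine Finset.sum_congr rfl fun a ha => hWG a ?_
    exact (isUnit_or_eq_zero_zmod_pow_one a).resolve_right (Finset.ne_of_mem_erase ha)
  rw [hGsum, hG0, hW0, sub_self, sub_eq_zero] at hsplit
  exact hsplit

end GramRelation

/-! ### Lowest levels and passage to power series. -/

section Assembly

variable {p : ℕ} [Fact p.Prime]

theorem mem_primitiveSymm_one_iff (C : Matrix (Fin 2) (Fin 2) (ZMod (p ^ (0 + 1)))) :
    C ∈ primitiveSymm p (0 + 1) ↔ C.IsSymm ∧ C ≠ 0 := by
  simp only [primitiveSymm, Finset.mem_filter, Finset.mem_univ, true_and]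
  refine and_congr_right fun _ => ?_
  have : Nontrivial (ZMod (p ^ (0 + 1))) := by
    rw [zero_add, pow_one]
    exact (ZMod.nontrivial_iff).2 (Fact.out : p.Prime).ne_one
  constructor
  · rintro ⟨i, j, h⟩ rfl
    exact not_isUnit_zero h
  · intro h
    by_contra! hcon
    exact h (by
      ext i j
      exact (isUnit_or_eq_zero_zmod_pow_one _).resolve_left (hcon i j))

theorem sum_primitiveSymm_one (f : Matrix (Fin 2) (Fin 2) (ZMod (p ^ (0 + 1))) → ℂ)
    [DecidablePred (Matrix.IsSymm : Matrix (Fin 2) (Fin 2) (ZMod (p ^ (0 + 1))) → Prop)] :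
    ∑ C ∈ primitiveSymm p (0 + 1), f C =
      ∑ C : Matrix (Fin 2) (Fin 2) (ZMod (p ^ (0 + 1))) with C.IsSymm, f C - f 0 := by
  classical
  rw [← Finset.sum_erase_eq_sub
    (Finset.mem_filter.2 ⟨Finset.mem_univ _, Matrix.isSymm_zero⟩)]
  refine Finset.sum_congr ?_ fun _ _ => rfl
  ext C
  rw [mem_primitiveSymm_one_iff, Finset.mem_erase, Finset.mem_filter]
  simp [and_comm]

theorem stdAddChar_trace_level_one (u : ℕ) (T : Matrix (Fin 2) (Fin 2) ℤ_[p])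
    (C : Matrix (Fin 2) (Fin 2) (ZMod (p ^ (0 + 1)))) :
    ZMod.stdAddChar (-(C * (((p * u : ℕ) : ℤ_[p]) • T).map
      (PadicInt.toZModPow (0 + 1))).trace) = (1 : ℂ) := by
  have hp0 : (p : ZMod (p ^ (0 + 1))) = 0 := by
    have := ZMod.natCast_self (p ^ (0 + 1))
    simpa using this
  have : (((p * u : ℕ) : ℤ_[p]) • T).map (PadicInt.toZModPow (0 + 1)) = 0 := by
    ext i j
    rw [Matrix.map_apply, Matrix.smul_apply, smul_eq_mul, map_mul, map_natCast, Nat.cast_mul, hp0,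
      zero_mul, zero_mul, Matrix.zero_apply]
  rw [this, Matrix.mul_zero, Matrix.trace_zero, neg_zero, AddChar.map_zero_eq_one]

/-- The matrix puT vanishes modulo p, so the character is trivial. The sum over all singular C is 1,
and C = 0 accounts for exactly that. -/
theorem yangR1Coeff_one_eq_zero {u : ℕ} {S₀ : Matrix (Fin 3) (Fin 3) ℤ_[p]}
    (hS₀ : HasUnaryMean (-1) S₀) (T : Matrix (Fin 2) (Fin 2) ℤ_[p]) :
    yangR1Coeff S₀ (((p * u : ℕ) : ℤ_[p]) • T) (0 + 1) = 0 := by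
  classical
  have hp : (p : ℂ) ≠ 0 := Nat.cast_ne_zero.2 (Fact.out : p.Prime).ne_zero
  have h := yangR1Coeff_of_hasUnaryMean hS₀ (((p * u : ℕ) : ℤ_[p]) • T) (0 + 1)
  simp only [stdAddChar_trace_level_one, mul_one, map_neg, map_one] at h
  rw [sum_primitiveSymm_one, sum_isSymm_det_eq_zero_gaussMean_one isUnit_one.neg,
    if_pos (Matrix.det_zero), gaussMean_zero_right, sub_self] at h
  exact (mul_eq_zero.1 h).resolve_left (pow_ne_zero _ hp)

/-- Only degrees 1 and 2 occur. The singular part cancels as for R_1, and the total sum p minus the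
term of C = 0 is the coefficient of y². -/
theorem levelPoly_one_eval {u : ℕ} {S₀ : Matrix (Fin 3) (Fin 3) ℤ_[p]}
    (hS₀ : HasUnaryMean (-1) S₀) (T : Matrix (Fin 2) (Fin 2) ℤ_[p]) (y : ℂ) :
    (levelPoly S₀ (((p * u : ℕ) : ℤ_[p]) • T) (0 + 1)).eval (p * y) = (p - 1) * y ^ 2 := by
  classical
  rw [levelPoly_eval_of_hasUnaryMean hS₀]
  simp only [stdAddChar_trace_level_one, mul_one, map_neg, map_one]
  have h1 : ∀ C : Matrix (Fin 2) (Fin 2) (ZMod (p ^ (0 + 1))),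
      gaussMean (0 + 1) (-1) C * y ^ denomExp C = gaussMean (0 + 1) (-1) C * y ^ 2 +
        (if C.det = 0 then gaussMean (0 + 1) (-1) C else 0) * (y - y ^ 2) := by
    intro C
    have hle := logOrder_le C.det
    split_ifs with h
    · rw [denomExp, h, (logOrder_eq_zero_iff _).2 rfl]
      ring
    · have h1 : logOrder C.det ≠ 0 := fun h0 => h ((logOrder_eq_zero_iff _).1 h0)
      have h2 : denomExp C = 2 := by rw [denomExp]; omega
      rw [h2]
      ring
  rw [Finset.sum_congr rfl fun C _ => h1 C, Finset.sum_add_distrib, ← Finset.sum_mul,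
    ← Finset.sum_mul, sum_primitiveSymm_one, sum_primitiveSymm_one,
    sum_isSymm_det_eq_zero_gaussMean_one isUnit_one.neg, sum_isSymm_gaussMean_one isUnit_one.neg,
    if_pos (Matrix.det_zero), gaussMean_zero_right, sub_self, zero_mul, add_zero]

-- Levels up to M of 𝓛 face levels up to M + 1 of L₀. The base case pairs level 0 with levels 0 and
-- 1, and the summand (X + p)/p makes it balance.
open Polynomial in
theorem levelPoly_relation {u : ℕ} (hu : u.Coprime p)
    {S S₀ : Matrix (Fin 3) (Fin 3) ℤ_[p]} (hS : HasUnaryMean (-((p * u : ℕ) : ℤ_[p])) S)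
    (hS₀ : HasUnaryMean (-1) S₀) (T : Matrix (Fin 2) (Fin 2) ℤ_[p]) (M : ℕ) :
    (X ^ 2 * ∑ k ∈ Finset.range (M + 1), levelPoly S T k : ℂ[X]) =
      C (p : ℂ) * ∑ k ∈ Finset.range (M + 2), levelPoly S₀ (((p * u : ℕ) : ℤ_[p]) • T) k +
      (X - C (p : ℂ)) * (∑ k ∈ Finset.range (M + 1),
        C (yangR1Coeff S₀ (((p * u : ℕ) : ℤ_[p]) • T) (k + 1)) * X ^ (k + 1) +
        C ((p : ℂ)⁻¹) * (X + C (p : ℂ))) := by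
  have hp : (p : ℂ) ≠ 0 := Nat.cast_ne_zero.2 (Fact.out : p.Prime).ne_zero
  induction M with
  | zero =>
    refine Polynomial.funext fun x => ?_
    obtain ⟨y, rfl⟩ : ∃ y, x = p * y := ⟨x / p, by field_simp⟩
    have h1 := levelPoly_one_eval (u := u) hS₀ T y
    rw [zero_add] at h1
    have h2 := yangR1Coeff_one_eq_zero (u := u) hS₀ T
    rw [zero_add] at h2
    simp only [zero_add, Finset.sum_range_succ, Finset.sum_range_zero,
      levelPoly_zero, eval_mul, eval_pow, eval_X, eval_one, eval_add, eval_C, eval_sub, h1, h2]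
    field_simp
    ring
  | succ M ih =>
    rw [Finset.sum_range_succ _ (M + 1), Finset.sum_range_succ _ (M + 2),
      Finset.sum_range_succ (fun k => C (yangR1Coeff S₀ (((p * u : ℕ) : ℤ_[p]) • T) (k + 1)) *
        X ^ (k + 1)) (M + 1), mul_add, ih]
    have hstep : (X ^ 2 * levelPoly S T (M + 1) : ℂ[X]) =
        C (p : ℂ) * levelPoly S₀ (((p * u : ℕ) : ℤ_[p]) • T) (M + 2) + (X - C (p : ℂ)) *
          (C (yangR1Coeff S₀ (((p * u : ℕ) : ℤ_[p]) • T) (M + 2)) * X ^ (M + 2)) := by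
      refine Polynomial.funext fun x => ?_
      obtain ⟨y, rfl⟩ : ∃ y, x = p * y := ⟨x / p, by field_simp⟩
      simp only [eval_mul, eval_pow, eval_X, eval_add, eval_C, eval_sub]
      exact levelPoly_eval_relation hu hS hS₀ T M.succ_ne_zero y
    rw [hstep]
    ring

theorem X_pow_dvd_repSeries_sub {ι : Type} [Fintype ι] (S : Matrix ι ι ℤ_[p])
    (T : Matrix (Fin 2) (Fin 2) ℤ_[p]) {m M : ℕ} (hm : m ≤ M) :
    (PowerSeries.X : ℂ⟦X⟧) ^ m ∣ repSeries S T -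
      ((∑ k ∈ Finset.range M, levelPoly S T k : Polynomial ℂ) : ℂ⟦X⟧) := by
  rw [PowerSeries.X_pow_dvd_iff]
  intro n hn
  rw [map_sub, repSeries, PowerSeries.coeff_mk, Polynomial.coeff_coe, Polynomial.finsetSum_coeff,
    sub_eq_zero]
  refine Finset.sum_subset (Finset.range_mono (by omega)) fun k _ hk => ?_
  exact coeff_levelPoly_eq_zero S T (by simpa using hk)

theorem X_pow_dvd_yangR1_sub {ι : Type} [Fintype ι] (S : Matrix ι ι ℤ_[p])
    (T : Matrix (Fin 2) (Fin 2) ℤ_[p]) (M : ℕ) :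
    (PowerSeries.X : ℂ⟦X⟧) ^ (M + 1) ∣ yangR1 S T -
      ((∑ k ∈ Finset.range (M + 1), Polynomial.C (yangR1Coeff S T (k + 1)) *
        Polynomial.X ^ (k + 1) : Polynomial ℂ) : ℂ⟦X⟧) := by
  rw [PowerSeries.X_pow_dvd_iff]
  intro n hn
  rw [map_sub, yangR1, PowerSeries.coeff_mk, Polynomial.coeff_coe, Polynomial.finsetSum_coeff,
    sub_eq_zero]
  simp only [Polynomial.coeff_C_mul_X_pow]
  rcases n with _ | n
  · simp
  · rw [if_neg n.succ_ne_zero, Finset.sum_eq_single n]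
    · simp
    · intro k _ hk
      rw [if_neg (by omega)]
    · intro h
      simp at h
      omega

/-- Level k starts in degree k, so modulo X^(n+1) each series may be replaced by a finite sum of
levels, to which `levelPoly_relation` applies. -/
theorem X_sq_mul_repSeries {u : ℕ} (hu : u.Coprime p)
    {S S₀ : Matrix (Fin 3) (Fin 3) ℤ_[p]} (hS : HasUnaryMean (-((p * u : ℕ) : ℤ_[p])) S)
    (hS₀ : HasUnaryMean (-1) S₀) (T : Matrix (Fin 2) (Fin 2) ℤ_[p]) :
    (PowerSeries.X : ℂ⟦X⟧) ^ 2 * repSeries S T =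
      PowerSeries.C (p : ℂ) * repSeries S₀ (((p * u : ℕ) : ℤ_[p]) • T) +
      (PowerSeries.X - PowerSeries.C (p : ℂ)) * (yangR1 S₀ (((p * u : ℕ) : ℤ_[p]) • T) +
        PowerSeries.C ((p : ℂ)⁻¹) * (PowerSeries.X + PowerSeries.C (p : ℂ))) := by
  rw [← sub_eq_zero]
  ext n
  set T' := ((p * u : ℕ) : ℤ_[p]) • T
  obtain ⟨a, ha⟩ := X_pow_dvd_repSeries_sub S T (le_refl (n + 1))
  obtain ⟨b, hb⟩ := X_pow_dvd_repSeries_sub S₀ T' (Nat.le_succ (n + 1))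
  obtain ⟨c, hc⟩ := X_pow_dvd_yangR1_sub S₀ T' n
  have h := congrArg (fun P : Polynomial ℂ => (P : ℂ⟦X⟧)) (levelPoly_relation hu hS hS₀ T n)
  simp only [Polynomial.coe_mul, Polynomial.coe_add, Polynomial.coe_sub, Polynomial.coe_pow,
    Polynomial.coe_X, Polynomial.coe_C] at h
  refine (PowerSeries.X_pow_dvd_iff (n := n + 1)).1 ?_ n n.lt_succ_self
  refine ⟨PowerSeries.X ^ 2 * a - PowerSeries.C (p : ℂ) * b -
    (PowerSeries.X - PowerSeries.C (p : ℂ)) * c, ?_⟩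
  linear_combination h + PowerSeries.X ^ 2 * ha - PowerSeries.C (p : ℂ) * hb -
    (PowerSeries.X - PowerSeries.C (p : ℂ)) * hc

theorem coe_eq_single_mul_coe {f h : ℂ⟦X⟧} (hf : PowerSeries.X ^ 2 * f = h) :
    (f : LaurentSeries ℂ) = HahnSeries.single (-2 : ℤ) (1 : ℂ) * (h : LaurentSeries ℂ) := by
  rw [← hf, PowerSeries.coe_mul, PowerSeries.coe_pow, PowerSeries.coe_X, ← mul_assoc, sq,
    HahnSeries.single_mul_single, HahnSeries.single_mul_single]
  norm_num

theorem isSymm_of_baseChange {ι ι' : Type} [Fintype ι] [Fintype ι'] {S : Matrix ι ι ℤ_[p]}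
    {S' : Matrix ι' ι' ℤ_[p]} (hS' : S'.IsSymm) {g : Matrix ι' ι ℤ_[p]}
    (hS : S = g.transpose * S' * g) : S.IsSymm := by
  rw [hS, Matrix.IsSymm, Matrix.transpose_mul, Matrix.transpose_mul, Matrix.transpose_transpose,
    hS'.eq, Matrix.mul_assoc]

theorem isSymm_and_hasUnaryMean_of_isGramMatrix (hp2 : p ≠ 2) {N : ℕ} (hN : N ≠ 0)
    {S : Matrix (Fin 3) (Fin 3) ℤ_[p]}
    (hS : IsGramMatrix (fun x => (N : ℚ_[p]) * x.det) (latticeCalL p N) S) :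
    S.IsSymm ∧ HasUnaryMean (-(N : ℤ_[p])) S := by
  obtain ⟨g, h, hgh, hhg, hSg⟩ := exists_baseChange_of_isGramMatrix hp2 hN hS
  exact ⟨isSymm_of_baseChange (addHyperbolic_isSymm (by ext; rfl) 1) hSg,
    fun T k B hB => charMean_gram hp2 hgh hhg hSg T hB⟩

end Assembly

theorem mainTheorem5 (p : ℕ) [Fact p.Prime] (N : ℕ) (hodd : Odd N) (hsq : Squarefree N)
    (hpN : p ∣ N) (T : Matrix (Fin 2) (Fin 2) ℤ_[p]) (hT : T.IsSymm)
    (S S₀ : Matrix (Fin 3) (Fin 3) ℤ_[p])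
    (hS : IsGramMatrix (fun x => (N : ℚ_[p]) * x.det) (latticeCalL p N) S)
    (hS₀ : IsGramMatrix (fun x => x.det) (latticeL0 p) S₀) :
    (∃! f : PowerSeries ℂ, IsRepDensity S T f) ∧
    (∃! g : PowerSeries ℂ, IsRepDensity S₀ ((N : ℤ_[p]) • T) g) ∧
    (T.det ≠ 0 → ∃ F G R : Polynomial ℂ,
      IsRepDensityPolynomial S T F ∧ IsRepDensityPolynomial S₀ ((N : ℤ_[p]) • T) G ∧
      (R : PowerSeries ℂ) = yangR1 S₀ ((N : ℤ_[p]) • T)) ∧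
    ∀ f g : PowerSeries ℂ, IsRepDensity S T f → IsRepDensity S₀ ((N : ℤ_[p]) • T) g →
      (f : LaurentSeries ℂ) = HahnSeries.single (-2 : ℤ) (1 : ℂ) *
        ((PowerSeries.C (p : ℂ) * g + (PowerSeries.X - PowerSeries.C (p : ℂ)) *
          (yangR1 S₀ ((N : ℤ_[p]) • T) +
            PowerSeries.C ((p : ℂ)⁻¹) * (PowerSeries.X + PowerSeries.C (p : ℂ))) :
          PowerSeries ℂ) : LaurentSeries ℂ) := by
  have hpr : p.Prime := Fact.out
  have hN0 : N ≠ 0 := hsq.ne_zero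
  have hp2 : p ≠ 2 := by
    rintro rfl
    exact (Nat.not_even_iff_odd.2 hodd) (even_iff_two_dvd.2 hpN)
  obtain ⟨u, rfl⟩ := hpN
  -- Squarefreeness says that p divides N exactly once, so the shift is by exactly one level.
  have hu : u.Coprime p := by
    rw [Nat.coprime_comm, hpr.coprime_iff_not_dvd]
    intro h
    exact hpr.one_lt.ne' (Nat.isUnit_iff.1 (hsq p (mul_dvd_mul_left p h)))
  obtain ⟨hSs, hSm⟩ := isSymm_and_hasUnaryMean_of_isGramMatrix hp2 hN0 hS
  -- L₀ is 𝓛 with N = 1, so one normal form serves both lattices.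
  have hS₀' : IsGramMatrix (fun x => ((1 : ℕ) : ℚ_[p]) * x.det) (latticeCalL p 1) S₀ := by
    rw [← latticeL0_eq]
    simpa using hS₀
  obtain ⟨hS₀s, hS₀m⟩ := isSymm_and_hasUnaryMean_of_isGramMatrix hp2 one_ne_zero hS₀'
  rw [Nat.cast_one] at hS₀m
  have hT' : (((p * u : ℕ) : ℤ_[p]) • T).IsSymm := hT.smul _
  have hf := isRepDensity_repSeries hp2 hSs hT
  have hg := isRepDensity_repSeries hp2 hS₀s hT'
  refine ⟨⟨_, hf, fun f' hf' => isRepDensity_unique hf' hf⟩,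
    ⟨_, hg, fun g' hg' => isRepDensity_unique hg' hg⟩, fun hdet => ?_, fun f g hf' hg' => ?_⟩
  · have hdet' : (((p * u : ℕ) : ℤ_[p]) • T).det ≠ 0 := by
      rw [Matrix.det_smul]
      exact mul_ne_zero (pow_ne_zero _ (Nat.cast_ne_zero.2 hN0)) hdet
    obtain ⟨F, hF⟩ := exists_isRepDensityPolynomial hp2 hSs hT hdet
    obtain ⟨G, hG⟩ := exists_isRepDensityPolynomial hp2 hS₀s hT' hdet'
    obtain ⟨R, hR⟩ := exists_polynomial_eq_yangR1 hp2 S₀ hT' hdet'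
    exact ⟨F, G, R, hF, hG, hR⟩
  · rw [isRepDensity_unique hf' hf, isRepDensity_unique hg' hg]
    exact coe_eq_single_mul_coe (X_sq_mul_repSeries hu hSm hS₀m T)
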